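/- Let $V$ be a real Banach space and let $\overline V = V\oplus\mathbb R$, with any norm inducing the product topology. **Paths.** Let $\mathcal P(V)$ be the set of continuous paths $x:[0,1]\to V$ with $x(0)=0$ and $\|x\|_{1\text{-var}}=\sup\sum_i\|x(t_{i+1})-x(t_i)\|<\infty$, with the metric $d(x,y)=\|x-y\|_{1\text{-var}}$. For $x\in\mathcal P(V)$ let $\overline x(t)=(x(t),t)$, so $\overline x\in\mathcal P(\overline V)$. **Tensors.** Fix an admissible system of norms on the algebraic tensor powers $\overline V^{\otimes n}$, $n\ge 0$. That is: the norms for $n=0,1$ are $|\cdot|$ on $\mathbb R$ and the given norm on $\overline V$; permutations of the tensor factors are isometries; $\|\xi\otimes\eta\|\le\|\xi\|\,\|\eta\|$; and $f\otimes g$ is a bounded functional on $\overline V^{\otimes(m+n)}$ whenever $f,g$ are bounded functionals on $\overline V^{\otimes m},\overline V^{\otimes n}$. Write $\overline V^{\otimes n}$ also for the completions. Let $T$ be the Banach space of sequences $\mathbf t=(\mathbf t^m)_{m\ge 0}$, $\mathbf t^m\in\overline V^{\otimes m}$, with $\|\mathbf t\|^2=\sum_m\|\mathbf t^m\|^2<\infty$,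 and let $T_1=\{\mathbf t\in T:\mathbf t^0=1\}$. **Signature and normalization.** For $y\in\mathcal P(\overline V)$ let $S(y)=\big(\int_{0\le t_1\le\dots\le t_m\le 1}dy(t_1)\otimes\cdots\otimes dy(t_m)\big)_{m\ge 0}\in T_1$, the integrals being iterated Riemann–Stieltjes integrals. Let $\Lambda:T_1\to T_1$ be a tensor normalization: a continuous injective map, with values in $\{\|\mathbf t\|\le K\}$ for some $K>0$, of the form $\Lambda(\mathbf t)=(\lambda(\mathbf t)^m\mathbf t^m)_{m\ge 0}$ for a function $\lambda:T_1\to(0,\infty)$. **Strict topology.** For a topological space $\mathcal X$, the strict topology on $C_b(\mathcal X,\mathbb R)$ is generated by the seminorms $p_\psi(f)=\sup_x|f(x)\psi(x)|$, where $\psi:\mathcal X\to\mathbb R$ ranges over the bounded functions that vanish at infinity (for all $\epsilon>0$ there is a compact $K$ with $|\psi|<\epsilon$ off $K$). **Claim.** The iterated Riemann–Stieltjes integrals of $\overline x$ exist for every $x\in\mathcal P(V)$, and the map $\overline\Phi:\mathcal P(V)\to T_1\subset T$, $\overline\Phi(x)=\Lambda(S(\overline x))$, 1. is a continuous injection of $\mathcal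 P(V)$ into a bounded subset of $T_1$; 2. is universal to $C_b(\mathcal P(V),\mathbb R)$ with the strict topology: the functions $x\mapsto\langle\ell,\overline\Phi(x)\rangle$, $\ell\in T'$, belong to $C_b(\mathcal P(V),\mathbb R)$ and form a strictly dense subset of it; 3. is characteristic to the space of finite (signed) regular Borel measures on $\mathcal P(V)$: each such $\mu$ defines a strictly continuous functional $f\mapsto\int f\,d\mu$ on $C_b(\mathcal P(V),\mathbb R)$, and $\mu\mapsto\big(\ell\mapsto\int\langle\ell,\overline\Phi(x)\rangle\,\mu(dx)\big)$, $\ell\in T'$, is injective on these measures. -/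

import Mathlib

open scoped TensorProduct

noncomputable section

namespace SigFeature

universe u

/-! ### Paths of bounded variation -/

/-- Continuous paths of bounded variation `[0,1] → V` that start at `0`. -/
structure BVPath (V : Type*) [NormedAddCommGroup V] where
  toMap : C(unitInterval, V)
  boundedVariation : BoundedVariationOn toMap Set.univ
  map_zero : toMap 0 = 0

namespace BVPath

variable {V : Type*} [NormedAddCommGroup V]

instance : CoeFun (BVPath V) (fun _ => unitInterval → V) := ⟨fun x => x.toMap⟩

theorem ext' {x y : BVPath V} (h : ∀ t, x t = y t) : x = y := by
  cases x; cases y; congr 1; ext t; exact h t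

theorem eVariationOn_add_le {f g : unitInterval → V} :
    eVariationOn (fun t => f t + g t) Set.univ
      ≤ eVariationOn f Set.univ + eVariationOn g Set.univ := by
  refine iSup_le fun p => ?_
  calc _ ≤ ∑ i ∈ Finset.range p.1, (edist (f (p.2.1 (i + 1))) (f (p.2.1 i))
            + edist (g (p.2.1 (i + 1))) (g (p.2.1 i))) :=
        Finset.sum_le_sum fun i _ => edist_add_add_le _ _ _ _
    _ ≤ _ := by
        rw [Finset.sum_add_distrib]
        exact add_le_add (eVariationOn.sum_le p.2.2.1 p.2.2.2)
          (eVariationOn.sum_le p.2.2.1 p.2.2.2)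

theorem eVariationOn_neg_eq {f : unitInterval → V} :
    eVariationOn (fun t => - f t) Set.univ = eVariationOn f Set.univ := by
  simp [eVariationOn]

theorem variation_sub_ne_top (x y : BVPath V) :
    eVariationOn (fun t => x t - y t) Set.univ ≠ ⊤ := by
  have h := eVariationOn_add_le (f := x) (g := fun t => - y t)
  rw [eVariationOn_neg_eq] at h
  simp only [← sub_eq_add_neg] at h
  exact ne_top_of_le_ne_top (ENNReal.add_ne_top.2 ⟨x.boundedVariation, y.boundedVariation⟩) h

/-- The `1`-variation metric `d(x, y) = ‖x - y‖_{1-var}`. -/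
instance : MetricSpace (BVPath V) where
  dist x y := (eVariationOn (fun t => x t - y t) Set.univ).toReal
  dist_self x := by
    have : eVariationOn (fun t => x t - x t) Set.univ = 0 := by
      simp [eVariationOn]
    rw [this, ENNReal.toReal_zero]
  dist_comm x y := by
    congr 1
    rw [← eVariationOn_neg_eq]
    simp
  dist_triangle x y z := by
    rw [← ENNReal.toReal_add (variation_sub_ne_top x y) (variation_sub_ne_top y z)]
    refine ENNReal.toReal_mono
      (ENNReal.add_ne_top.2 ⟨variation_sub_ne_top x y, variation_sub_ne_top y z⟩) ?_
    have h := eVariationOn_add_le (f := fun t => x t - y t) (g := fun t => y t - z t)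
    simpa using h
  eq_of_dist_eq_zero {x y} h := by
    have h0 : eVariationOn (fun t => x t - y t) Set.univ = 0 :=
      ((ENNReal.toReal_eq_zero_iff _).1 h).resolve_right (variation_sub_ne_top x y)
    refine ext' fun t => ?_
    have := (eVariationOn.eq_zero_iff _).1 h0 t (Set.mem_univ t) 0 (Set.mem_univ 0)
    rw [edist_eq_zero] at this
    simpa [x.map_zero, y.map_zero, sub_eq_zero] using this

instance : MeasurableSpace (BVPath V) := borel _

instance : BorelSpace (BVPath V) := ⟨rfl⟩

variable {W : Type*} [NormedAddCommGroup W] [NormedSpace ℝ V] [NormedSpace ℝ W]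

/-- The path with time as an extra coordinate, `t ↦ (x t, t)`. The space `W` is `V × ℝ` with
some norm that induces the product topology, and `e` is the identification. -/
def timeAugment (e : (V × ℝ) ≃L[ℝ] W) (x : BVPath V) : BVPath W where
  toMap := ⟨fun t => e (x t, (t : ℝ)), by fun_prop⟩
  boundedVariation := by
    have hid : BoundedVariationOn (fun t : unitInterval => (t : ℝ)) Set.univ := by
      have hm : MonotoneOn (fun t : unitInterval => (t : ℝ)) Set.univ := fun a _ b _ hab => hab
      have h := hm.eVariationOn_eq (Set.mem_univ (0 : unitInterval))
        (Set.mem_univ (1 : unitInterval))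
      have hu : (Set.univ ∩ Set.Icc (0 : unitInterval) 1) = Set.univ := by
        ext t; simp [unitInterval.le_one']
      rw [hu] at h
      exact ne_top_of_le_ne_top ENNReal.ofReal_ne_top h.le
    have hp : BoundedVariationOn (fun t : unitInterval => (x t, (t : ℝ))) Set.univ := by
      refine ne_top_of_le_ne_top (ENNReal.add_ne_top.2 ⟨x.boundedVariation, hid⟩) ?_
      refine iSup_le fun p => ?_
      calc _ ≤ ∑ i ∈ Finset.range p.1, (edist (x (p.2.1 (i + 1))) (x (p.2.1 i))
              + edist ((p.2.1 (i + 1) : unitInterval) : ℝ) ((p.2.1 i : unitInterval) : ℝ)) :=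
            Finset.sum_le_sum fun i _ => by
              rw [Prod.edist_eq]; exact max_le le_self_add le_add_self
        _ ≤ _ := by
            rw [Finset.sum_add_distrib]
            exact add_le_add (eVariationOn.sum_le p.2.2.1 p.2.2.2)
              (eVariationOn.sum_le (f := fun t : unitInterval => (t : ℝ)) p.2.2.1 p.2.2.2)
    exact (e : (V × ℝ) →L[ℝ] W).lipschitz.comp_boundedVariationOn hp
  map_zero := by
    simp only [ContinuousMap.coe_mk, x.map_zero, Set.Icc.coe_zero]
    exact _root_.map_zero e

end BVPath

/-! ### Tensor powers of a Banach space -/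

/-- An admissible system of norms on the algebraic tensor powers `W^{⊗ n}`: the norms on
`W^{⊗ 0} = ℝ` and `W^{⊗ 1} = W` are the given ones, permutations of the factors are isometries,
`‖ξ ⊗ η‖ ≤ ‖ξ‖ ‖η‖`, and the tensor product of two bounded functionals is bounded. -/
structure AdmissibleTensorNorms (W : Type u) [NormedAddCommGroup W] [NormedSpace ℝ W] where
  nrm : ∀ n : ℕ, Seminorm ℝ (⨂[ℝ]^n W)
  eq_zero_of_nrm : ∀ (n : ℕ) (ξ : ⨂[ℝ]^n W), nrm n ξ = 0 → ξ = 0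
  nrm_unit : nrm 0 (PiTensorProduct.tprod ℝ Fin.elim0) = 1
  nrm_one : ∀ w : W, nrm 1 (PiTensorProduct.tprod ℝ fun _ => w) = ‖w‖
  nrm_perm : ∀ (n : ℕ) (σ : Equiv.Perm (Fin n)) (ξ : ⨂[ℝ]^n W),
    nrm n (PiTensorProduct.reindex ℝ (fun _ => W) σ ξ) = nrm n ξ
  nrm_mul_le : ∀ (m n : ℕ) (ξ : ⨂[ℝ]^m W) (η : ⨂[ℝ]^n W),
    nrm (m + n) (TensorPower.mulEquiv (ξ ⊗ₜ[ℝ] η)) ≤ nrm m ξ * nrm n η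
  bounded_mul : ∀ (m n : ℕ) (f : ⨂[ℝ]^m W →ₗ[ℝ] ℝ) (g : ⨂[ℝ]^n W →ₗ[ℝ] ℝ),
    (∃ C : ℝ, ∀ ξ, |f ξ| ≤ C * nrm m ξ) → (∃ C : ℝ, ∀ η, |g η| ≤ C * nrm n η) →
    ∃ C : ℝ, ∀ ζ : ⨂[ℝ]^(m + n) W,
      |LinearMap.mul' ℝ ℝ (TensorProduct.map f g (TensorPower.mulEquiv.symm ζ))|
        ≤ C * nrm (m + n) ζ

variable {W : Type u} [NormedAddCommGroup W] [NormedSpace ℝ W]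

/-- The algebraic tensor power `W^{⊗ n}`, as a type that carries the norm chosen by `N`. -/
def AlgTensor (_N : AdmissibleTensorNorms W) (n : ℕ) : Type u := ⨂[ℝ]^n W

namespace AlgTensor

variable (N : AdmissibleTensorNorms W) (n : ℕ)

instance : AddCommGroup (AlgTensor N n) := inferInstanceAs (AddCommGroup (⨂[ℝ]^n W))

instance : Module ℝ (AlgTensor N n) := inferInstanceAs (Module ℝ (⨂[ℝ]^n W))

instance : NormedAddCommGroup (AlgTensor N n) :=
  AddGroupNorm.toNormedAddCommGroup
    { toFun := fun ξ => N.nrm n ξ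
      map_zero' := map_zero (N.nrm n)
      add_le' := map_add_le_add (N.nrm n)
      neg' := map_neg_eq_map (N.nrm n)
      eq_zero_of_map_eq_zero' := N.eq_zero_of_nrm n }

theorem norm_def (ξ : AlgTensor N n) : ‖ξ‖ = N.nrm n ξ := rfl

instance : NormedSpace ℝ (AlgTensor N n) where
  norm_smul_le r ξ := le_of_eq (map_smul_eq_mul (N.nrm n) r ξ)

/-- The element `1` of the algebraic `W^{⊗ 0} = ℝ`. -/
def unit : AlgTensor N 0 := (PiTensorProduct.tprod ℝ Fin.elim0 : ⨂[ℝ]^0 W)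

variable {N n}

/-- `ξ ↦ ξ ⊗ w` as a bounded operator `W^{⊗ n} → W^{⊗ (n+1)}`. -/
def mulRight (w : W) : AlgTensor N n →L[ℝ] AlgTensor N (n + 1) :=
  LinearMap.mkContinuous
    (TensorPower.mulEquiv.toLinearMap ∘ₗ
      (TensorProduct.mk ℝ (⨂[ℝ]^n W) (⨂[ℝ]^1 W)).flip (PiTensorProduct.tprod ℝ fun _ => w))
    ‖w‖ (fun ξ => by
      rw [mul_comm, ← N.nrm_one w]
      exact N.nrm_mul_le n 1 ξ _)

end AlgTensor

/-- The Banach space `W^{⊗ n}`: the completion of the algebraic tensor power. -/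
abbrev BanachTensor (N : AdmissibleTensorNorms W) (n : ℕ) : Type u :=
  UniformSpace.Completion (AlgTensor N n)

/-- `ξ ⊗ w` for `ξ` in the completed tensor power and `w : W`. -/
def tensorRight (N : AdmissibleTensorNorms W) (n : ℕ) (ξ : BanachTensor N n) (w : W) :
    BanachTensor N (n + 1) :=
  (AlgTensor.mulRight (N := N) (n := n) w).completion ξ

/-- The element `1` of `W^{⊗ 0} = ℝ`. -/
def tensorUnit (N : AdmissibleTensorNorms W) : BanachTensor N 0 :=
  (AlgTensor.unit N : BanachTensor N 0)

/-- The Banach space of sequences `t = (t⁰, t¹, …)`, `tᵐ ∈ W^{⊗ m}`, with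
`‖t‖² = ∑ ‖tᵐ‖² < ∞`. -/
abbrev TensorSeries (N : AdmissibleTensorNorms W) : Type u :=
  lp (fun n => BanachTensor N n) 2

/-- The elements of `TensorSeries` with zeroth component `1`. -/
abbrev TensorSeriesOne (N : AdmissibleTensorNorms W) : Type u :=
  {t : TensorSeries N // t 0 = tensorUnit N}

/-- `Λ` is a tensor normalization: continuous, injective, with values in a ball, and of the
form `t ↦ δ_{λ(t)} t` with `λ(t) > 0`, where `δ_r t = (t⁰, r t¹, r² t², …)`. -/
structure IsTensorNormalization (N : AdmissibleTensorNorms W)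
    (Λ : TensorSeriesOne N → TensorSeriesOne N) : Prop where
  continuous : Continuous Λ
  injective : Function.Injective Λ
  bounded : ∃ K : ℝ, 0 < K ∧ ∀ t, ‖(Λ t : TensorSeries N)‖ ≤ K
  dilation : ∃ lam : TensorSeriesOne N → ℝ, (∀ t, 0 < lam t) ∧
    ∀ t m, (Λ t : TensorSeries N) m = lam t ^ m • (t : TensorSeries N) m

/-! ### Riemann–Stieltjes integrals and the signature -/

/-- `J` is the Riemann–Stieltjes integral `∫ₐᵇ f ⊗ dg` with respect to the product `mul`: the sums
`∑ mul (f (sᵢ)) (g (tᵢ₊₁) - g (tᵢ))` over tagged partitions of `[a, b]` converge to `J` as the mesh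
tends to `0`. -/
def HasRSIntegral {E F G : Type*} [NormedAddCommGroup F] [NormedAddCommGroup G]
    (mul : E → F → G) (f : unitInterval → E) (g : unitInterval → F) (a b : unitInterval) (J : G) : Prop :=
  ∀ ε : ℝ, 0 < ε → ∃ δ : ℝ, 0 < δ ∧ ∀ (n : ℕ) (t s : ℕ → unitInterval), t 0 = a → t n = b →
    (∀ i < n, t i ≤ s i ∧ s i ≤ t (i + 1) ∧ (t (i + 1) : ℝ) - t i < δ) →
    ‖∑ i ∈ Finset.range n, mul (f (s i)) (g (t (i + 1)) - g (t i)) - J‖ < ε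

open Classical in
/-- The Riemann–Stieltjes integral (`0` if it does not exist). -/
def rsIntegral {E F G : Type*} [NormedAddCommGroup F] [NormedAddCommGroup G]
    (mul : E → F → G) (f : unitInterval → E) (g : unitInterval → F) (a b : unitInterval) : G :=
  if h : ∃ J, HasRSIntegral mul f g a b J then h.choose else 0

/-- The iterated integrals
`∫_{0 ≤ t₁ ≤ ⋯ ≤ tₘ ≤ t} dx(t₁) ⊗ ⋯ ⊗ dx(tₘ)`, by
`X⁰(t) = 1` and `Xᵐ⁺¹(t) = ∫₀ᵗ Xᵐ(s) ⊗ dx(s)`. -/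
def iteratedIntegral (N : AdmissibleTensorNorms W) (x : unitInterval → W) : ∀ m : ℕ, unitInterval → BanachTensor N m
  | 0 => fun _ => tensorUnit N
  | m + 1 => fun t => rsIntegral (tensorRight N m) (iteratedIntegral N x m) x 0 t

theorem norm_tensorUnit (N : AdmissibleTensorNorms W) : ‖tensorUnit N‖ = 1 := by
  rw [tensorUnit, UniformSpace.Completion.norm_coe]
  exact N.nrm_unit

theorem norm_tensorRight_le (N : AdmissibleTensorNorms W) (n : ℕ) (ξ : BanachTensor N n) (w : W) :
    ‖tensorRight N n ξ w‖ ≤ ‖ξ‖ * ‖w‖ := by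
  induction ξ using UniformSpace.Completion.induction_on with
  | hp =>
    refine isClosed_le ?_ (by fun_prop)
    exact ((AlgTensor.mulRight (N := N) (n := n) w).completion.continuous).norm
  | ih ξ =>
    have h : tensorRight N n (ξ : BanachTensor N n) w
        = ((AlgTensor.mulRight (N := N) w ξ : AlgTensor N (n + 1)) : BanachTensor N (n + 1)) := by
      simp [tensorRight]
    rw [h, UniformSpace.Completion.norm_coe, UniformSpace.Completion.norm_coe, ← N.nrm_one w]
    exact N.nrm_mul_le n 1 ξ _

theorem HasRSIntegral.norm_le {E F G : Type*} [NormedAddCommGroup F] [NormedAddCommGroup G]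
    {mul : E → F → G} {f : unitInterval → E} {g : unitInterval → F} {b : unitInterval} {J : G}
    (h : HasRSIntegral mul f g 0 b J) {C : ℝ}
    (hC : ∀ (n : ℕ) (t : ℕ → unitInterval), Monotone t → t 0 = 0 → t n = b →
      ‖∑ i ∈ Finset.range n, mul (f (t i)) (g (t (i + 1)) - g (t i))‖ ≤ C) : ‖J‖ ≤ C := by
  refine le_of_forall_pos_le_add fun ε hε => ?_
  obtain ⟨δ, hδ, H⟩ := h ε hε
  obtain ⟨n, hn⟩ := exists_nat_one_div_lt hδ
  let t : ℕ → unitInterval := fun i => ⟨min ((i : ℝ) / (n + 1)) 1 * b, by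
    refine ⟨by have := b.2.1; positivity, mul_le_one₀ (min_le_right _ _) b.2.1 b.2.2⟩⟩
  have ht : Monotone t := by
    intro i j hij
    have hc : (i : ℝ) ≤ j := by exact_mod_cast hij
    change min ((i : ℝ) / (n + 1)) 1 * (b : ℝ) ≤ min ((j : ℝ) / (n + 1)) 1 * (b : ℝ)
    have := b.2.1
    gcongr
  have h0 : t 0 = 0 := by ext; simp [t]
  have h1 : t (n + 1) = b := by
    ext
    have : ((n : ℝ) + 1) / (n + 1) = 1 := div_self (by positivity)
    simp [t, this]
  have hm : ∀ i < n + 1, t i ≤ t i ∧ t i ≤ t (i + 1) ∧ (t (i + 1) : ℝ) - t i < δ := by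
    intro i hi
    refine ⟨le_rfl, ht (Nat.le_succ i), lt_of_le_of_lt ?_ hn⟩
    have hpos : (0 : ℝ) < n + 1 := by positivity
    have hi' : (i : ℝ) + 1 ≤ n + 1 := by exact_mod_cast hi
    have e1 : min ((i : ℝ) / (n + 1)) 1 = i / (n + 1) :=
      min_eq_left ((div_le_one hpos).2 (by linarith))
    have e2 : min (((i : ℝ) + 1) / (n + 1)) 1 = (i + 1) / (n + 1) :=
      min_eq_left ((div_le_one hpos).2 hi')
    have : (t (i + 1) : ℝ) - t i = 1 / (n + 1) * b := by
      simp only [t, Nat.cast_add, Nat.cast_one, e1, e2]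
      ring
    rw [this]
    exact mul_le_of_le_one_right (by positivity) b.2.2
  have hH := H (n + 1) t t h0 h1 hm
  have hS := hC (n + 1) t ht h0 h1
  rw [norm_sub_rev] at hH
  calc ‖J‖ ≤ ‖J - ∑ i ∈ Finset.range (n + 1), mul (f (t i)) (g (t (i + 1)) - g (t i))‖
        + ‖∑ i ∈ Finset.range (n + 1), mul (f (t i)) (g (t (i + 1)) - g (t i))‖ := by
          simpa using norm_add_le
            (J - ∑ i ∈ Finset.range (n + 1), mul (f (t i)) (g (t (i + 1)) - g (t i)))
            (∑ i ∈ Finset.range (n + 1), mul (f (t i)) (g (t (i + 1)) - g (t i)))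
    _ ≤ C + ε := by linarith

theorem pow_mul_sub_le {a b : ℝ} (ha : 0 ≤ a) (hab : a ≤ b) (m : ℕ) :
    (m + 1) * (a ^ m * (b - a)) ≤ b ^ (m + 1) - a ^ (m + 1) := by
  induction m with
  | zero => simp
  | succ m ih =>
    have h1 : 0 ≤ b ^ (m + 1) - a ^ (m + 1) := sub_nonneg.2 (pow_le_pow_left₀ ha hab _)
    have h2 : a * ((m + 1) * (a ^ m * (b - a))) ≤ b * (b ^ (m + 1) - a ^ (m + 1)) :=
      (mul_le_mul_of_nonneg_left ih ha).trans (mul_le_mul_of_nonneg_right hab h1)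
    have h3 : b ^ (m + 1 + 1) - a ^ (m + 1 + 1)
        = b * (b ^ (m + 1) - a ^ (m + 1)) + a ^ (m + 1) * (b - a) := by ring
    rw [h3]
    push_cast
    have h4 : ((m : ℝ) + 1 + 1) * (a ^ (m + 1) * (b - a))
        = a * ((m + 1) * (a ^ m * (b - a))) + a ^ (m + 1) * (b - a) := by ring
    rw [h4]
    linarith

theorem norm_iteratedIntegral_le (N : AdmissibleTensorNorms W) (x : BVPath W) (m : ℕ)
    (t : unitInterval) :
    ‖iteratedIntegral N x m t‖
      ≤ (eVariationOn x (Set.Icc 0 t)).toReal ^ m / (m.factorial : ℝ) := by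
  have hfin : ∀ s : Set unitInterval, eVariationOn x s ≠ ⊤ := fun s =>
    ne_top_of_le_ne_top x.boundedVariation (eVariationOn.mono _ (Set.subset_univ s))
  induction m generalizing t with
  | zero => simp [iteratedIntegral, norm_tensorUnit]
  | succ m ih =>
    simp only [iteratedIntegral, rsIntegral]
    split_ifs with h
    · refine h.choose_spec.norm_le fun n u hu h0 hn => ?_
      set v : unitInterval → ℝ := fun s => (eVariationOn x (Set.Icc 0 s)).toReal with hv
      have hinc : ∀ i, ‖x (u (i + 1)) - x (u i)‖ ≤ v (u (i + 1)) - v (u i) := by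
        intro i
        have hle := hu (Nat.le_succ i)
        have e := eVariationOn.Icc_add_Icc (x : unitInterval → W) (s := Set.univ)
          (unitInterval.nonneg' (t := u i)) hle (Set.mem_univ _)
        simp only [Set.univ_inter] at e
        have d : edist (x (u (i + 1))) (x (u i))
            ≤ eVariationOn x (Set.Icc (u i) (u (i + 1))) :=
          eVariationOn.edist_le _ (Set.right_mem_Icc.2 hle) (Set.left_mem_Icc.2 hle)
        have d' := ENNReal.toReal_mono (hfin _) d
        rw [edist_dist, ENNReal.toReal_ofReal dist_nonneg, dist_eq_norm] at d'
        simp only [hv]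
        rw [← e, ENNReal.toReal_add (hfin _) (hfin _)]
        linarith
      have hv0 : ∀ s, 0 ≤ v s := fun s => ENNReal.toReal_nonneg
      have hf : (0 : ℝ) < m.factorial := by exact_mod_cast m.factorial_pos
      have hf' : ((m + 1).factorial : ℝ) = (m + 1) * m.factorial := by
        rw [Nat.factorial_succ]; push_cast; ring
      calc _ ≤ ∑ i ∈ Finset.range n, (v (u (i + 1)) ^ (m + 1) / ((m + 1).factorial : ℝ)
              - v (u i) ^ (m + 1) / ((m + 1).factorial : ℝ)) := by
            refine norm_sum_le_of_le _ fun i _ => ?_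
            refine (norm_tensorRight_le N m _ _).trans ?_
            refine (mul_le_mul (ih (u i)) (hinc i) (norm_nonneg _)
              (div_nonneg (pow_nonneg (hv0 _) _) hf.le)).trans ?_
            have hmono : v (u i) ≤ v (u (i + 1)) := by
              have := (norm_nonneg _).trans (hinc i); linarith
            have key := pow_mul_sub_le (hv0 (u i)) hmono m
            rw [hf', ← sub_div, le_div_iff₀ (by positivity)]
            refine le_trans (le_of_eq ?_) key
            simp only [hv]
            field_simp
        _ = v t ^ (m + 1) / ((m + 1).factorial : ℝ)
              - v 0 ^ (m + 1) / ((m + 1).factorial : ℝ) := by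
            rw [Finset.sum_range_sub (fun i => v (u i) ^ (m + 1) / ((m + 1).factorial : ℝ)),
              h0, hn]
        _ ≤ v t ^ (m + 1) / ((m + 1).factorial : ℝ) :=
            sub_le_self _ (div_nonneg (pow_nonneg (hv0 _) _) (by positivity))
    · rw [norm_zero]
      positivity

theorem memℓp_iteratedIntegral (N : AdmissibleTensorNorms W) (x : BVPath W) :
    Memℓp (fun m => iteratedIntegral N x m 1) 2 := by
  refine memℓp_gen ?_
  set L := (eVariationOn x (Set.Icc (0 : unitInterval) 1)).toReal
  refine Summable.of_nonneg_of_le (fun m => by positivity) (fun m => ?_)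
    (Real.summable_pow_div_factorial (L ^ 2))
  have h := norm_iteratedIntegral_le N x m 1
  have hf : (1 : ℝ) ≤ m.factorial := by exact_mod_cast m.factorial_pos
  have e : (2 : ENNReal).toReal = ((2 : ℕ) : ℝ) := by simp
  rw [e, Real.rpow_natCast]
  calc ‖iteratedIntegral N x m 1‖ ^ 2 ≤ (L ^ m / m.factorial) ^ 2 := by gcongr
    _ = (L ^ 2) ^ m / (m.factorial * m.factorial) := by rw [div_pow]; ring
    _ ≤ (L ^ 2) ^ m / m.factorial := by
        gcongr
        nlinarith

/-- The signature `S(x) = (1, ∫ dx, ∫ dx^{⊗ 2}, …)` of a path of bounded variation. -/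
def signature (N : AdmissibleTensorNorms W) (x : BVPath W) : TensorSeriesOne N :=
  ⟨⟨fun m => iteratedIntegral N x m 1, memℓp_iteratedIntegral N x⟩, rfl⟩

/-- The normalized signature of the time-augmented path, `x ↦ Λ (S (x̄))`. -/
def normalizedSignature {V : Type*} [NormedAddCommGroup V] [NormedSpace ℝ V]
    (e : (V × ℝ) ≃L[ℝ] W) (N : AdmissibleTensorNorms W)
    (Λ : TensorSeriesOne N → TensorSeriesOne N) (x : BVPath V) : TensorSeries N :=
  (Λ (signature N (x.timeAugment e))).1

/-! ### The strict topology -/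

/-- The bounded functions `ψ : X → ℝ` that vanish at infinity. -/
def BoundedVanishing (X : Type*) [TopologicalSpace X] : Type _ :=
  {ψ : X → ℝ // (∃ C : ℝ, ∀ x, |ψ x| ≤ C) ∧
    ∀ ε : ℝ, 0 < ε → ∃ K : Set X, IsCompact K ∧ ∀ x ∉ K, |ψ x| < ε}

instance (X : Type*) [TopologicalSpace X] : Nonempty (BoundedVanishing X) :=
  ⟨⟨fun _ => 0, ⟨0, by simp⟩, fun ε hε => ⟨∅, isCompact_empty, fun _ _ => by simpa using hε⟩⟩⟩

/-- The space `C_b(X, ℝ)`, as a type that carries the strict topology. -/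
def StrictCb (X : Type*) [TopologicalSpace X] : Type _ := BoundedContinuousFunction X ℝ

namespace StrictCb

variable {X : Type*} [TopologicalSpace X]

instance : AddCommGroup (StrictCb X) :=
  inferInstanceAs (AddCommGroup (BoundedContinuousFunction X ℝ))

instance : Module ℝ (StrictCb X) := inferInstanceAs (Module ℝ (BoundedContinuousFunction X ℝ))

instance : FunLike (StrictCb X) X ℝ :=
  inferInstanceAs (FunLike (BoundedContinuousFunction X ℝ) X ℝ)

theorem bddAbove_mul (f : StrictCb X) (ψ : BoundedVanishing X) :
    BddAbove (Set.range fun x => |f x * ψ.1 x|) := by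
  obtain ⟨C, hC⟩ := ψ.2.1
  let f' : BoundedContinuousFunction X ℝ := f
  refine ⟨‖f'‖ * C, ?_⟩
  rintro _ ⟨x, rfl⟩
  simp only [abs_mul]
  exact mul_le_mul (f'.norm_coe_le_norm x) (hC x) (abs_nonneg _) (norm_nonneg _)

/-- The seminorm `p_ψ(f) = sup_x |f(x) ψ(x)|`. -/
def strictSeminorm (ψ : BoundedVanishing X) : Seminorm ℝ (StrictCb X) :=
  Seminorm.of (fun f => ⨆ x, |f x * ψ.1 x|)
    (fun f g => by
      refine Real.iSup_le (fun x => ?_) (add_nonneg (Real.iSup_nonneg fun x => abs_nonneg _)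
        (Real.iSup_nonneg fun x => abs_nonneg _))
      have h : (f + g) x * ψ.1 x = f x * ψ.1 x + g x * ψ.1 x := add_mul (f x) (g x) (ψ.1 x)
      rw [h]
      exact (abs_add_le _ _).trans
        (add_le_add (le_ciSup (bddAbove_mul f ψ) x) (le_ciSup (bddAbove_mul g ψ) x)))
    (fun r f => by
      rw [Real.norm_eq_abs, Real.mul_iSup_of_nonneg (abs_nonneg r)]
      congr 1
      ext x
      have h : (r • f) x * ψ.1 x = r * (f x * ψ.1 x) := mul_assoc r (f x) (ψ.1 x)
      rw [h, abs_mul])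

/-- The strict topology: the topology generated by the seminorms `p_ψ`. -/
instance : TopologicalSpace (StrictCb X) :=
  (SeminormFamily.moduleFilterBasis (𝕜 := ℝ)
    (strictSeminorm : SeminormFamily ℝ (StrictCb X) (BoundedVanishing X))).topology

end StrictCb

/-! ### Universal and characteristic feature maps -/

section FeatureMaps

variable {X : Type*} [TopologicalSpace X] {E : Type*} [AddCommGroup E] [Module ℝ E]
  [TopologicalSpace E]

/-- `⟨ℓ, Φ(·)⟩` lies in `C_b(X, ℝ)` for every continuous linear functional `ℓ`. -/
def IsCbFeature (Φ : X → E) : Prop :=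
  ∀ l : E →L[ℝ] ℝ, ∃ f : StrictCb X, ∀ x, f x = l (Φ x)

/-- `Φ` is universal to `C_b(X, ℝ)` with the strict topology: the functions `⟨ℓ, Φ(·)⟩`,
`ℓ ∈ E'`, lie in `C_b(X, ℝ)` and are dense in it. -/
def IsUniversal (Φ : X → E) : Prop :=
  IsCbFeature Φ ∧ Dense {f : StrictCb X | ∃ l : E →L[ℝ] ℝ, ∀ x, f x = l (Φ x)}

/-- The (finite, signed) Borel measures on `X` that are regular. -/
def RegularSignedMeasure (X : Type*) [TopologicalSpace X] [MeasurableSpace X] [BorelSpace X] :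
    Type _ :=
  {μ : MeasureTheory.SignedMeasure X // μ.totalVariation.Regular}

/-- `∫ f dμ = ∫ f dμ⁺ - ∫ f dμ⁻` for a signed measure `μ`. -/
def signedIntegral [MeasurableSpace X] (μ : MeasureTheory.SignedMeasure X) (f : X → ℝ) : ℝ :=
  ∫ x, f x ∂μ.toJordanDecomposition.posPart - ∫ x, f x ∂μ.toJordanDecomposition.negPart

/-- `Φ` is characteristic to the space of finite regular Borel measures: these measures act on
`C_b(X, ℝ)` as strictly continuous functionals, the functions `⟨ℓ, Φ(·)⟩` lie in `C_b(X, ℝ)`,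
and `μ ↦ (ℓ ↦ ∫ ⟨ℓ, Φ(x)⟩ μ(dx))` is injective on these measures. -/
def IsCharacteristicToMeasures [MeasurableSpace X] [BorelSpace X] (Φ : X → E) : Prop :=
  (∀ μ : RegularSignedMeasure X, ∃ D : StrictCb X →L[ℝ] ℝ, ∀ f, D f = signedIntegral μ.1 f) ∧
  IsCbFeature Φ ∧
  Function.Injective fun (μ : RegularSignedMeasure X) (l : E →L[ℝ] ℝ) =>
    signedIntegral μ.1 fun x => l (Φ x)

end FeatureMaps

end SigFeature

end

open SigFeature

noncomputable section

namespace SigFeature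

universe u

open Filter Topology Finset
open scoped TensorProduct

/-! ### Riemann–Stieltjes sums -/

/-! The proof combines a Stone–Weierstrass theorem for the strict topology with the algebraic
structure of iterated integrals.

Existence and continuity. Riemann–Stieltjes sums of a continuous integrand against an integrator of
bounded variation satisfy a Cauchy criterion (`norm_sum_sub_sum_le`), and the indefinite integral is
again continuous, so the integration can be iterated. The iterated integrals of level `m + 1` of two
paths differ by at most the distance of the paths times `L ^ m / m!`, where `L` is the sum of their
lengths (`norm_iteratedIntegral_sub_le`). Summing over the levels shows that the signature is
locally Lipschitz.

Algebra. A word of bounded functionals on `W` gives a functional on tensor series, and on signatures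
it takes a scalar iterated integral as value. Integration by parts (`mul_integral_eq_add`) turns a
product of two such integrals into a combination of integrals over words of the total length
(`wordIntegral_mul_mem`). The normalization multiplies level `n` by `λ ^ n`; since the product
formula is homogeneous in the length, the normalized word functionals still span an algebra, now of
bounded functions.

Separation. The word that consists of the time coordinate has integral `1`, so its normalized value
is `λ` itself and the normalization can be undone. The shuffle product then expresses `∫ f(x t) t ^
k dt` by iterated integrals over words. These moments determine the continuous function `f ∘ x`, and
the functionals `f` separate the points (`eq_of_wordIntegral_eq`). This gives injectivity as well.

Density and measures. A separating algebra of bounded functions is strictly dense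
(`dense_strict_of_separatesPoints`). A finite regular measure is tight, hence integrates some
function that grows at infinity, whose reciprocal is a weight that makes the measure strictly
continuous (`exists_strictCLM`). Two measures that agree on a dense set therefore agree on all of
`C_b`, which determines them. -/

/-- The increments of `g` are dominated by those of `v`. -/
def Controls {F : Type*} [NormedAddCommGroup F] (v : unitInterval → ℝ) (g : unitInterval → F) :
    Prop :=
  ∀ a b, a ≤ b → ‖g b - g a‖ ≤ v b - v a

/-- Retraction of a linear order onto `[p, q]`. -/
def clamp {α : Type*} [LinearOrder α] (p q u : α) : α := max p (min u q)

/-! ### Intersections of intervals by clamping -/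

section Clamp

variable {α : Type*} [LinearOrder α]

theorem clamp_mono (p q : α) : Monotone (clamp p q) := fun _ _ h =>
  max_le_max le_rfl (min_le_min h le_rfl)

theorem clamp_of_le {p q u : α} (h : u ≤ p) : clamp p q u = p :=
  max_eq_left ((min_le_left _ _).trans h)

theorem clamp_of_ge {p q u : α} (hpq : p ≤ q) (h : q ≤ u) : clamp p q u = q := by
  rw [clamp, min_eq_right h, max_eq_right hpq]

/-- If the intervals `[p, q]` and `[r, s]` meet, clamping the ends of one to the other gives the
ends of the intersection, whichever is clamped. If they do not meet, both clamped intervals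
degenerate to a point. This lets two partitions exchange their roles in a double sum. -/
theorem clamp_cross {p q r s : α} (hpq : p ≤ q) (hrs : r ≤ s) :
    (p ≤ s ∧ r ≤ q ∧ clamp p q s = clamp r s q ∧ clamp p q r = clamp r s p) ∨
      (clamp p q s = clamp p q r ∧ clamp r s q = clamp r s p) := by
  by_cases h1 : p ≤ s
  · by_cases h2 : r ≤ q
    · left
      refine ⟨h1, h2, ?_, ?_⟩
      · rw [clamp, clamp, max_eq_right (le_min h1 hpq), max_eq_right (le_min h2 hrs), min_comm]
      · rw [clamp, clamp, min_eq_left h2, min_eq_left h1, max_comm]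
    · right
      push Not at h2
      rw [clamp_of_ge hpq (h2.le.trans hrs), clamp_of_ge hpq h2.le, clamp_of_le h2.le,
        clamp_of_le (hpq.trans h2.le)]
      exact ⟨rfl, rfl⟩
  · right
    push Not at h1
    rw [clamp_of_le h1.le, clamp_of_le (hrs.trans h1.le), clamp_of_ge hrs (h1.le.trans hpq),
      clamp_of_ge hrs h1.le]
    exact ⟨rfl, rfl⟩

end Clamp

section RS

variable {E F G : Type*} [NormedAddCommGroup E] [NormedAddCommGroup F] [NormedAddCommGroup G]

theorem Controls.mono {v : unitInterval → ℝ} {g : unitInterval → F} (hv : Controls v g) :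
    Monotone v := fun a b h => by
  have := (norm_nonneg _).trans (hv a b h)
  linarith

theorem exists_modulus {f : unitInterval → E} (hf : Continuous f) {ε : ℝ} (hε : 0 < ε) :
    ∃ δ : ℝ, 0 < δ ∧ ∀ p q : unitInterval, |(p : ℝ) - q| < δ → ‖f p - f q‖ ≤ ε := by
  obtain ⟨δ, hδ, H⟩ := Metric.uniformContinuous_iff.1
    (CompactSpace.uniformContinuous_of_continuous hf) ε hε
  refine ⟨δ, hδ, fun p q hpq => ?_⟩
  rw [← dist_eq_norm]
  refine (H ?_).le
  rwa [Subtype.dist_eq, Real.dist_eq]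

/-- The points `i / (k + 1)` of the uniform partition of `[0,1]`. -/
def unifPt (k i : ℕ) : unitInterval :=
  ⟨min ((i : ℝ) / (k + 1)) 1, le_min (by positivity) zero_le_one, min_le_right _ _⟩

theorem unifPt_zero (k : ℕ) : unifPt k 0 = 0 := by
  ext; simp [unifPt]

theorem unifPt_last (k : ℕ) : unifPt k (k + 1) = 1 := by
  ext
  have : ((k : ℝ) + 1) / (k + 1) = 1 := div_self (by positivity)
  simp [unifPt, this]

theorem unifPt_mono (k : ℕ) : Monotone (unifPt k) := by
  intro i j hij
  have hc : (i : ℝ) ≤ j := by exact_mod_cast hij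
  change min ((i : ℝ) / (k + 1)) 1 ≤ min ((j : ℝ) / (k + 1)) 1
  gcongr

theorem unifPt_sub_le (k i : ℕ) : (unifPt k (i + 1) : ℝ) - unifPt k i ≤ 1 / (k + 1) := by
  have h : ((i + 1 : ℕ) : ℝ) / (k + 1) = (i : ℝ) / (k + 1) + 1 / (k + 1) := by
    push_cast; ring
  have h' : (0 : ℝ) ≤ 1 / (k + 1) := by positivity
  simp only [unifPt, h]
  rcases min_cases ((i : ℝ) / (k + 1)) 1 with ⟨h1, h2⟩ | ⟨h1, h2⟩
  · rw [h1]; linarith [min_le_left ((i : ℝ) / (k + 1) + 1 / (k + 1)) 1]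
  · rw [h1]; linarith [min_le_right ((i : ℝ) / (k + 1) + 1 / (k + 1)) 1]

theorem coe_min (a b : unitInterval) : ((min a b : unitInterval) : ℝ) = min (a : ℝ) b := by
  rcases le_total a b with h | h
  · rw [min_eq_left h, min_eq_left (show (a : ℝ) ≤ b from h)]
  · rw [min_eq_right h, min_eq_right (show (b : ℝ) ≤ a from h)]

theorem min_unifPt_sub_le (k i : ℕ) (b : unitInterval) :
    ((min (unifPt k (i + 1)) b : unitInterval) : ℝ) - (min (unifPt k i) b : unitInterval)
      ≤ 1 / (k + 1) := by
  refine le_trans ?_ (unifPt_sub_le k i)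
  have h : (unifPt k i : ℝ) ≤ unifPt k (i + 1) := unifPt_mono k (Nat.le_succ i)
  rw [coe_min, coe_min]
  rcases min_cases (unifPt k i : ℝ) b with ⟨h1, h2⟩ | ⟨h1, h2⟩
  · rw [h1]; linarith [min_le_left (unifPt k (i + 1) : ℝ) b]
  · rw [h1]; linarith [min_le_right (unifPt k (i + 1) : ℝ) b]

theorem min_unifPt_le (k i : ℕ) (b : unitInterval) :
    min (unifPt k i) b ≤ min (unifPt k (i + 1)) b :=
  min_le_min (unifPt_mono k (Nat.le_succ i)) le_rfl

theorem eventually_one_div_lt {δ : ℝ} (hδ : 0 < δ) : ∀ᶠ k : ℕ in atTop, 1 / ((k : ℝ) + 1) < δ :=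
  (tendsto_one_div_add_atTop_nhds_zero_nat (𝕜 := ℝ)).eventually_lt_const hδ

/-- A Riemann–Stieltjes integral is the limit of the sums over the uniform partitions. -/
theorem HasRSIntegral.tendsto_sum {E' F' : Type*} [NormedAddCommGroup F'] {mul : E' → F' → G}
    {f : unitInterval → E'}
    {g : unitInterval → F'} {b : unitInterval} {J : G} (h : HasRSIntegral mul f g 0 b J)
    (s : ℕ → ℕ → unitInterval) (hs : ∀ k i, min (unifPt k i) b ≤ s k i)
    (hs' : ∀ k i, s k i ≤ min (unifPt k (i + 1)) b) :
    Tendsto (fun k : ℕ => ∑ i ∈ range (k + 1),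
      mul (f (s k i)) (g (min (unifPt k (i + 1)) b) - g (min (unifPt k i) b))) atTop (𝓝 J) := by
  rw [Metric.tendsto_atTop']
  intro ε hε
  obtain ⟨δ, hδ, H⟩ := h ε hε
  obtain ⟨k₀, hk₀⟩ := eventually_atTop.1 (eventually_one_div_lt hδ)
  refine ⟨k₀, fun k hk => ?_⟩
  rw [dist_eq_norm]
  -- Taking minima with `b` cuts the uniform partition of `[0,1]` off at `b`; the cells beyond `b`
  -- become degenerate.
  refine H (k + 1) (fun i => min (unifPt k i) b) (s k) ?_ ?_ fun i _ => ⟨hs k i, hs' k i, ?_⟩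
  · rw [unifPt_zero]; exact min_eq_left unitInterval.nonneg'
  · rw [unifPt_last]; exact min_eq_right unitInterval.le_one'
  · exact (min_unifPt_sub_le k i b).trans_lt (hk₀ k hk.le)

variable [NormedSpace ℝ E] [NormedSpace ℝ F] [NormedSpace ℝ G]

/-- The alternative `w = 0` covers pairs of cells that do not meet, where nothing is known about
`e`. -/
theorem norm_bilin_le (B : E →L[ℝ] F →L[ℝ] G) {e : E} {w : F} {η r : ℝ} (hη : 0 ≤ η)
    (h : w = 0 ∨ ‖e‖ ≤ η) (hr : ‖w‖ ≤ r) : ‖B e w‖ ≤ ‖B‖ * η * r := by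
  rcases h with rfl | h
  · have : 0 ≤ r := (norm_nonneg _).trans hr
    simp only [map_zero, norm_zero]; positivity
  · refine (B.le_opNorm₂ e w).trans ?_
    gcongr

/-- Two Riemann–Stieltjes sums over fine partitions of the same interval are close. -/
theorem norm_sum_sub_sum_le (B : E →L[ℝ] F →L[ℝ] G) {f : unitInterval → E}
    {g : unitInterval → F} {v : unitInterval → ℝ} (hv : Controls v g) {δ η : ℝ} (hη : 0 ≤ η)
    (hf : ∀ p q : unitInterval, |(p : ℝ) - q| < 2 * δ → ‖f p - f q‖ ≤ η) {a b : unitInterval}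
    {n n' : ℕ} {t s t' s' : ℕ → unitInterval} (ht0 : t 0 = a) (htn : t n = b) (ht0' : t' 0 = a)
    (htn' : t' n' = b)
    (ht : ∀ i < n, t i ≤ s i ∧ s i ≤ t (i + 1) ∧ (t (i + 1) : ℝ) - t i < δ)
    (ht' : ∀ i < n', t' i ≤ s' i ∧ s' i ≤ t' (i + 1) ∧ (t' (i + 1) : ℝ) - t' i < δ) :
    ‖∑ i ∈ range n, B (f (s i)) (g (t (i + 1)) - g (t i))
      - ∑ j ∈ range n', B (f (s' j)) (g (t' (j + 1)) - g (t' j))‖ ≤ ‖B‖ * η * (v b - v a) := by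
  have mono_of : ∀ {m : ℕ} {u : ℕ → unitInterval}, (∀ i < m, u i ≤ u (i + 1)) →
      ∀ i ≤ m, u 0 ≤ u i ∧ u i ≤ u m := by
    intro m u hu i hi
    constructor
    · induction i with
      | zero => exact le_rfl
      | succ k ih => exact (ih (by omega)).trans (hu k (by omega))
    · induction hi using Nat.decreasingInduction with
      | self => exact le_rfl
      | of_succ k hk ih => exact (hu k (by omega)).trans ih
  have hle : ∀ i < n, t i ≤ t (i + 1) := fun i hi => (ht i hi).1.trans (ht i hi).2.1
  have hle' : ∀ i < n', t' i ≤ t' (i + 1) := fun i hi => (ht' i hi).1.trans (ht' i hi).2.1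
  have hab := mono_of hle
  have hab' := mono_of hle'
  rw [ht0, htn] at hab
  rw [ht0', htn'] at hab'
  -- `d i j` is the increment of `g` over the intersection of the `i`-th cell of `t` with the `j`-th
  -- cell of `t'`. Both sums become double sums over these intersections, without a merged partition
  -- being formed.
  set d : ℕ → ℕ → F := fun i j =>
    g (clamp (t i) (t (i + 1)) (t' (j + 1))) - g (clamp (t i) (t (i + 1)) (t' j)) with hd
  set dv : ℕ → ℕ → ℝ := fun i j =>
    v (clamp (t i) (t (i + 1)) (t' (j + 1))) - v (clamp (t i) (t (i + 1)) (t' j)) with hdv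
  have hcross : ∀ i < n, ∀ j < n', d i j =
      g (clamp (t' j) (t' (j + 1)) (t (i + 1))) - g (clamp (t' j) (t' (j + 1)) (t i)) := by
    intro i hi j hj
    rcases clamp_cross (hle i hi) (hle' j hj) with ⟨-, -, h1, h2⟩ | ⟨h1, h2⟩
    · simp only [hd, h1, h2]
    · simp only [hd, h1, h2, sub_self]
  -- Two cells that meet have lengths below `δ`, so their tags are less than `2 * δ` apart.
  have hclose : ∀ i < n, ∀ j < n', d i j = 0 ∨ ‖f (s i) - f (s' j)‖ ≤ η := by
    intro i hi j hj
    rcases clamp_cross (hle i hi) (hle' j hj) with ⟨h1, h2, -, -⟩ | ⟨h1, h2⟩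
    · right
      apply hf
      obtain ⟨a1, a2, a3⟩ := ht i hi
      obtain ⟨b1, b2, b3⟩ := ht' j hj
      have a1 : (t i : ℝ) ≤ s i := a1
      have a2 : (s i : ℝ) ≤ t (i + 1) := a2
      have b1 : (t' j : ℝ) ≤ s' j := b1
      have b2 : (s' j : ℝ) ≤ t' (j + 1) := b2
      have h1 : (t i : ℝ) ≤ t' (j + 1) := h1
      have h2 : (t' j : ℝ) ≤ t (i + 1) := h2
      rw [abs_lt]
      constructor <;> linarith
    · left
      simp only [hd, h1, sub_self]
  have e1 : ∀ i < n, g (t (i + 1)) - g (t i) = ∑ j ∈ range n', d i j := by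
    intro i hi
    rw [sum_range_sub (fun j => g (clamp (t i) (t (i + 1)) (t' j))), ht0', htn',
      clamp_of_le (hab i hi.le).1, clamp_of_ge (hle i hi) (hab (i + 1) hi).2]
  have e1v : ∀ i < n, v (t (i + 1)) - v (t i) = ∑ j ∈ range n', dv i j := by
    intro i hi
    rw [sum_range_sub (fun j => v (clamp (t i) (t (i + 1)) (t' j))), ht0', htn',
      clamp_of_le (hab i hi.le).1, clamp_of_ge (hle i hi) (hab (i + 1) hi).2]
  have e2 : ∀ j < n', g (t' (j + 1)) - g (t' j) = ∑ i ∈ range n, d i j := by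
    intro j hj
    rw [sum_congr rfl fun i hi => hcross i (mem_range.1 hi) j hj,
      sum_range_sub (fun i => g (clamp (t' j) (t' (j + 1)) (t i))), ht0, htn,
      clamp_of_le (hab' j hj.le).1, clamp_of_ge (hle' j hj) (hab' (j + 1) hj).2]
  have s1 : ∑ i ∈ range n, B (f (s i)) (g (t (i + 1)) - g (t i))
      = ∑ i ∈ range n, ∑ j ∈ range n', B (f (s i)) (d i j) :=
    sum_congr rfl fun i hi => by rw [e1 i (mem_range.1 hi), map_sum]
  have s2 : ∑ j ∈ range n', B (f (s' j)) (g (t' (j + 1)) - g (t' j))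
      = ∑ i ∈ range n, ∑ j ∈ range n', B (f (s' j)) (d i j) := by
    rw [sum_comm]
    exact sum_congr rfl fun j hj => by rw [e2 j (mem_range.1 hj), map_sum]
  have s3 : v b - v a = ∑ i ∈ range n, ∑ j ∈ range n', dv i j := by
    rw [← sum_congr rfl fun i hi => e1v i (mem_range.1 hi), sum_range_sub (fun i => v (t i)),
      ht0, htn]
  rw [s1, s2, s3, ← sum_sub_distrib, mul_sum]
  refine norm_sum_le_of_le _ fun i hi => ?_
  rw [← sum_sub_distrib, mul_sum]
  refine norm_sum_le_of_le _ fun j hj => ?_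
  rw [← sub_apply, ← map_sub]
  exact norm_bilin_le B hη (hclose i (mem_range.1 hi) j (mem_range.1 hj))
    (hv _ _ (clamp_mono _ _ (hle' j (mem_range.1 hj))))

/-- Sums over any two sufficiently fine tagged partitions are close. The sums over the uniform
partitions thus form a Cauchy sequence, and its limit is close to every sum over a fine partition.
-/
theorem exists_hasRSIntegral [CompleteSpace G] (B : E →L[ℝ] F →L[ℝ] G) {f : unitInterval → E}
    (hf : Continuous f) {g : unitInterval → F} {v : unitInterval → ℝ} (hv : Controls v g)
    (b : unitInterval) : ∃ J, HasRSIntegral (fun e w => B e w) f g 0 b J := by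
  have key : ∀ ε : ℝ, 0 < ε → ∃ δ : ℝ, 0 < δ ∧ ∀ p q : unitInterval, |(p : ℝ) - q| < 2 * δ →
      ‖f p - f q‖ ≤ ε := by
    intro ε hε
    obtain ⟨δ, hδ, H⟩ := exists_modulus hf hε
    exact ⟨δ / 2, by positivity, fun p q hpq => H p q (by linarith)⟩
  -- The summand `1` keeps `C` positive when `B = 0` or `v b = v 0`, and makes the final estimate
  -- strict.
  set C := ‖B‖ * (v b - v 0) + 1 with hC
  have hCpos : 0 < C := by
    have := sub_nonneg.2 (hv.mono (unitInterval.nonneg' (t := b)))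
    positivity
  have key' : ∀ ε : ℝ, 0 < ε → ∃ δ : ℝ, 0 < δ ∧
      ∀ (n : ℕ) (t s : ℕ → unitInterval), t 0 = 0 → t n = b →
      (∀ i < n, t i ≤ s i ∧ s i ≤ t (i + 1) ∧ (t (i + 1) : ℝ) - t i < δ) →
      ∀ (n' : ℕ) (t' s' : ℕ → unitInterval), t' 0 = 0 → t' n' = b →
      (∀ i < n', t' i ≤ s' i ∧ s' i ≤ t' (i + 1) ∧ (t' (i + 1) : ℝ) - t' i < δ) →
      ‖∑ i ∈ range n, B (f (s i)) (g (t (i + 1)) - g (t i))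
        - ∑ j ∈ range n', B (f (s' j)) (g (t' (j + 1)) - g (t' j))‖ < ε := by
    intro ε hε
    obtain ⟨δ, hδ, H⟩ := key (ε / C) (by positivity)
    refine ⟨δ, hδ, fun n t s h0 hn ht n' t' s' h0' hn' ht' => ?_⟩
    refine (norm_sum_sub_sum_le B hv (by positivity) H h0 hn h0' hn' ht ht').trans_lt ?_
    have : ‖B‖ * (ε / C) * (v b - v 0) = (C - 1) * (ε / C) := by rw [hC]; ring
    rw [this]
    calc (C - 1) * (ε / C) < C * (ε / C) := by gcongr; linarith
      _ = ε := by field_simp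
  set S : ℕ → G := fun k => ∑ i ∈ range (k + 1), B (f (min (unifPt k i) b))
    (g (min (unifPt k (i + 1)) b) - g (min (unifPt k i) b)) with hS
  have part : ∀ {δ : ℝ}, 0 < δ → ∃ k₀ : ℕ, ∀ k ≥ k₀, ∀ i < k + 1,
      min (unifPt k i) b ≤ min (unifPt k i) b ∧ min (unifPt k i) b ≤ min (unifPt k (i + 1)) b ∧
      ((min (unifPt k (i + 1)) b : unitInterval) : ℝ) - (min (unifPt k i) b : unitInterval) < δ := by
    intro δ hδ
    obtain ⟨k₀, hk₀⟩ := eventually_atTop.1 (eventually_one_div_lt hδ)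
    exact ⟨k₀, fun k hk i _ => ⟨le_rfl, min_unifPt_le k i b,
      (min_unifPt_sub_le k i b).trans_lt (hk₀ k hk)⟩⟩
  have p0 : ∀ k, min (unifPt k 0) b = 0 := fun k => by
    rw [unifPt_zero]; exact min_eq_left unitInterval.nonneg'
  have p1 : ∀ k, min (unifPt k (k + 1)) b = b := fun k => by
    rw [unifPt_last]; exact min_eq_right unitInterval.le_one'
  have hcauchy : CauchySeq S := by
    rw [Metric.cauchySeq_iff]
    intro ε hε
    obtain ⟨δ, hδ, H⟩ := key' ε hε
    obtain ⟨k₀, hk₀⟩ := part hδ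
    refine ⟨k₀, fun m hm n hn => ?_⟩
    rw [dist_eq_norm]
    exact H _ (fun i => min (unifPt m i) b) _ (p0 m) (p1 m) (hk₀ m hm)
      _ (fun i => min (unifPt n i) b) _ (p0 n) (p1 n) (hk₀ n hn)
  obtain ⟨J, hJ⟩ := cauchySeq_tendsto_of_complete hcauchy
  refine ⟨J, fun ε hε => ?_⟩
  obtain ⟨δ, hδ, H⟩ := key' (ε / 2) (by positivity)
  obtain ⟨k₀, hk₀⟩ := part hδ
  refine ⟨δ, hδ, fun n t s h0 hn ht => ?_⟩
  have hlim := (tendsto_const_nhds (x := ∑ i ∈ range n, B (f (s i)) (g (t (i + 1)) - g (t i)))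
    (f := (atTop : Filter ℕ))).sub hJ |>.norm
  refine (le_of_tendsto hlim ?_).trans_lt (half_lt_self hε)
  filter_upwards [eventually_ge_atTop k₀] with k hk
  exact (H n t s h0 hn ht _ (fun i => min (unifPt k i) b) _ (p0 k) (p1 k) (hk₀ k hk)).le

/-- The integral over a short interval is close to the value of the integrand times the
increment of the integrator. -/
theorem norm_integral_sub_le (B : E →L[ℝ] F →L[ℝ] G) {f : unitInterval → E}
    {g : unitInterval → F} {v : unitInterval → ℝ} (hv : Controls v g) {δ η : ℝ} (hη : 0 ≤ η)
    (hf : ∀ p q : unitInterval, |(p : ℝ) - q| < δ → ‖f p - f q‖ ≤ η) {s r t : unitInterval}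
    (hsr : s ≤ r) (hrt : r ≤ t) (hst : (t : ℝ) - s < δ) {Js Jt : G}
    (hs : HasRSIntegral (fun e w => B e w) f g 0 s Js)
    (ht : HasRSIntegral (fun e w => B e w) f g 0 t Jt) :
    ‖Jt - Js - B (f r) (g t - g s)‖ ≤ ‖B‖ * η * (v t - v s) := by
  -- The tag `unifPt k i` need not be cut off at `b`: where it lies beyond `b`, the increment
  -- vanishes. The sums for `s` and `t` can therefore use the same tags and be subtracted term by
  -- term.
  have tag : ∀ {J : G} (b : unitInterval), HasRSIntegral (fun e w => B e w) f g 0 b J →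
      Tendsto (fun k : ℕ => ∑ i ∈ range (k + 1), B (f (unifPt k i))
        (g (min (unifPt k (i + 1)) b) - g (min (unifPt k i) b))) atTop (𝓝 J) := by
    intro J b h
    refine (h.tendsto_sum (fun k i => min (unifPt k i) b) (fun _ _ => le_rfl)
      (fun k i => min_unifPt_le k i b)).congr fun k => sum_congr rfl fun i _ => ?_
    rcases le_total (unifPt k i) b with h | h
    · rw [min_eq_left h]
    · rw [min_eq_right h, min_eq_right (h.trans (unifPt_mono k (Nat.le_succ i))), sub_self,
        map_zero, map_zero]
  have hst' : s ≤ t := hsr.trans hrt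
  have hc : ∀ u : unitInterval, g (min u t) - g (min u s) = g (clamp s t u) - g s := by
    intro u
    rcases le_total u s with h | h
    · rw [clamp_of_le h, min_eq_left h, min_eq_left (h.trans hst'), sub_self, sub_self]
    · rw [min_eq_right h, clamp, max_eq_right (le_min h hst')]
  have hlim := (((tag t ht).sub (tag s hs)).sub_const (B (f r) (g t - g s))).norm
  refine le_of_tendsto hlim ?_
  -- The tag of a cell that meets `[s, t]` is within `t - s` plus the mesh of `r`; the mesh is
  -- chosen to keep this below `δ`.
  have hpos : 0 < δ - ((t : ℝ) - s) := by linarith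
  filter_upwards [eventually_one_div_lt hpos] with k hk
  have teleg : g t - g s
      = ∑ i ∈ range (k + 1), (g (clamp s t (unifPt k (i + 1))) - g (clamp s t (unifPt k i))) := by
    rw [sum_range_sub (fun i => g (clamp s t (unifPt k i))), unifPt_zero, unifPt_last,
      clamp_of_le unitInterval.nonneg', clamp_of_ge hst' unitInterval.le_one']
  have telev : v t - v s
      = ∑ i ∈ range (k + 1), (v (clamp s t (unifPt k (i + 1))) - v (clamp s t (unifPt k i))) := by
    rw [sum_range_sub (fun i => v (clamp s t (unifPt k i))), unifPt_zero, unifPt_last,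
      clamp_of_le unitInterval.nonneg', clamp_of_ge hst' unitInterval.le_one']
  rw [teleg, map_sum, ← sum_sub_distrib, ← sum_sub_distrib, telev, mul_sum]
  refine norm_sum_le_of_le _ fun i _ => ?_
  have e : (g (min (unifPt k (i + 1)) t) - g (min (unifPt k i) t))
      - (g (min (unifPt k (i + 1)) s) - g (min (unifPt k i) s))
      = g (clamp s t (unifPt k (i + 1))) - g (clamp s t (unifPt k i)) := by
    rw [sub_sub_sub_comm, hc, hc]; abel
  rw [← map_sub, e, ← sub_apply, ← map_sub]
  have hmono := unifPt_mono k (Nat.le_succ i)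
  refine norm_bilin_le B hη ?_ (hv _ _ (clamp_mono _ _ hmono))
  by_cases h1 : t < unifPt k i
  · left
    rw [clamp_of_ge hst' (h1.le.trans hmono), clamp_of_ge hst' h1.le, sub_self]
  by_cases h2 : unifPt k (i + 1) < s
  · left
    rw [clamp_of_le h2.le, clamp_of_le (hmono.trans h2.le), sub_self]
  right
  apply hf
  have h1 : (unifPt k i : ℝ) ≤ t := not_lt.1 h1
  have h2 : (s : ℝ) ≤ unifPt k (i + 1) := not_lt.1 h2
  have h3 := unifPt_sub_le k i
  have h4 : (s : ℝ) ≤ r := hsr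
  have h5 : (r : ℝ) ≤ t := hrt
  rw [abs_lt]
  constructor <;> linarith

/-- The indefinite Riemann–Stieltjes integral is continuous. -/
theorem continuous_integral (B : E →L[ℝ] F →L[ℝ] G) {f : unitInterval → E} (hf : Continuous f)
    {g : unitInterval → F} (hg : Continuous g) {v : unitInterval → ℝ} (hv : Controls v g)
    {J : unitInterval → G} (hJ : ∀ t, HasRSIntegral (fun e w => B e w) f g 0 t (J t)) :
    Continuous J := by
  obtain ⟨M, hM⟩ := isCompact_univ.exists_bound_of_continuousOn hf.continuousOn
  have hM0 : 0 ≤ M := (norm_nonneg _).trans (hM 0 (Set.mem_univ _))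
  have hV : 0 ≤ v 1 - v 0 := sub_nonneg.2 (hv.mono unitInterval.le_one')
  refine UniformContinuous.continuous (Metric.uniformContinuous_iff.2 fun ε hε => ?_)
  -- Since `v` need not be continuous, `v t - v s` is only bounded by `v 1 - v 0`. Smallness comes
  -- from the oscillation of `f` in the error term and from the increment of `g` in the main term.
  set C := ‖B‖ * M + ‖B‖ * (v 1 - v 0) + 1 with hC
  have hCpos : 0 < C := by positivity
  obtain ⟨δ₁, hδ₁, Hf⟩ := exists_modulus hf (show 0 < ε / (2 * C) by positivity)
  obtain ⟨δ₂, hδ₂, Hg⟩ := exists_modulus hg (show 0 < ε / (2 * C) by positivity)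
  have main : ∀ s t : unitInterval, s ≤ t → dist t s < min δ₁ δ₂ → dist (J t) (J s) < ε := by
    intro s t hst hd
    have hst' : (s : ℝ) ≤ t := hst
    rw [Subtype.dist_eq, Real.dist_eq] at hd
    have h1 := norm_integral_sub_le B hv (by positivity) Hf le_rfl hst
      (((le_abs_self _).trans_lt hd).trans_le (min_le_left _ _)) (hJ s) (hJ t)
    have h2 := Hg t s (hd.trans_le (min_le_right _ _))
    have h3 : v t - v s ≤ v 1 - v 0 := by
      linarith [hv.mono (unitInterval.le_one' (t := t)), hv.mono (unitInterval.nonneg' (t := s))]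
    have h4 : ‖B (f s) (g t - g s)‖ ≤ ‖B‖ * M * (ε / (2 * C)) := by
      refine (B.le_opNorm₂ _ _).trans ?_
      gcongr
      exact hM s (Set.mem_univ _)
    have h5 : ‖B‖ * (ε / (2 * C)) * (v t - v s) ≤ ‖B‖ * (ε / (2 * C)) * (v 1 - v 0) := by gcongr
    rw [dist_eq_norm]
    calc ‖J t - J s‖ = ‖(J t - J s - B (f s) (g t - g s)) + B (f s) (g t - g s)‖ := by simp
      _ ≤ ‖B‖ * (ε / (2 * C)) * (v 1 - v 0) + ‖B‖ * M * (ε / (2 * C)) :=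
        (norm_add_le _ _).trans (add_le_add (h1.trans h5) h4)
      _ = (C - 1) * (ε / (2 * C)) := by rw [hC]; ring
      _ ≤ C * (ε / (2 * C)) := by gcongr; linarith
      _ = ε / 2 := by field_simp
      _ < ε := half_lt_self hε
  refine ⟨min δ₁ δ₂, lt_min hδ₁ hδ₂, fun {s t} hst => ?_⟩
  rcases le_total s t with h | h
  · rw [dist_comm]; rw [dist_comm] at hst; exact main s t h hst
  · exact main t s h hst

end RS

/-- Integration by parts for indefinite Riemann–Stieltjes integrals. -/
theorem mul_integral_eq_add {a b α β A C : unitInterval → ℝ} (ha : Continuous a)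
    (hb : Continuous b) (hα : Continuous α) (hβ : Continuous β) {v w : unitInterval → ℝ}
    (hv : Controls v α) (hw : Controls w β)
    (hA : ∀ t, HasRSIntegral (· * ·) a α 0 t (A t))
    (hC : ∀ t, HasRSIntegral (· * ·) b β 0 t (C t)) {t : unitInterval} {P Q : ℝ}
    (hP : HasRSIntegral (· * ·) (fun s => a s * C s) α 0 t P)
    (hQ : HasRSIntegral (· * ·) (fun s => b s * A s) β 0 t Q) : A t * C t = P + Q := by
  set B := ContinuousLinearMap.mul ℝ ℝ with hB
  have hB1 : ‖B‖ ≤ 1 := ContinuousLinearMap.opNorm_mul_le ℝ ℝ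
  have hAc : Continuous A := continuous_integral B ha hα hv hA
  have hCc : Continuous C := continuous_integral B hb hβ hw hC
  obtain ⟨M, hM⟩ := isCompact_univ.exists_bound_of_continuousOn hAc.continuousOn
  obtain ⟨M', hM'⟩ := isCompact_univ.exists_bound_of_continuousOn hCc.continuousOn
  have zero_of : ∀ {f g : unitInterval → ℝ} {J : ℝ}, HasRSIntegral (· * ·) f g 0 0 J → J = 0 := by
    intro f g J h
    refine tendsto_nhds_unique (h.tendsto_sum (fun _ _ => 0) (fun k i => min_le_right _ _)
      (fun k i => unitInterval.nonneg')) ?_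
    refine tendsto_const_nhds.congr fun k => ?_
    simp only [min_eq_right (unitInterval.nonneg'), sub_self, mul_zero, sum_const_zero]
  -- With `A 0 = 0` the product `A * C` vanishes at `0`, so its increments telescope to `A t * C t`.
  have hA0 := zero_of (hA 0)
  set u : ℕ → ℕ → unitInterval := fun k i => min (unifPt k i) t with hu
  have hu0 : ∀ k, u k 0 = 0 := fun k => by
    simp only [hu, unifPt_zero]; exact min_eq_left unitInterval.nonneg'
  have hu1 : ∀ k, u k (k + 1) = t := fun k => by
    simp only [hu, unifPt_last]; exact min_eq_right unitInterval.le_one'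
  have hule : ∀ k i, u k i ≤ u k (i + 1) := fun k i => min_unifPt_le k i t
  -- Left tags for `P` and right tags for `Q` match the identity `A'C' - AC = (A' - A)C + A'(C' -
  -- C)` on each cell, where a prime denotes the right end.
  have hlim := ((hP.tendsto_sum u (fun _ _ => le_rfl) hule).add
    (hQ.tendsto_sum (fun k i => u k (i + 1)) hule (fun _ _ => le_rfl)))
  have hlim' : Tendsto (fun k => (A t * C t) - (∑ i ∈ range (k + 1),
      a (u k i) * C (u k i) * (α (u k (i + 1)) - α (u k i)) + ∑ i ∈ range (k + 1),
      b (u k (i + 1)) * A (u k (i + 1)) * (β (u k (i + 1)) - β (u k i)))) atTop (𝓝 0) := by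
    rw [Metric.tendsto_atTop']
    intro ε hε
    have hV : 0 ≤ v t - v 0 := sub_nonneg.2 (hv.mono unitInterval.nonneg')
    have hW : 0 ≤ w t - w 0 := sub_nonneg.2 (hw.mono unitInterval.nonneg')
    have hM0 : 0 ≤ M := (norm_nonneg _).trans (hM 0 (Set.mem_univ _))
    have hM0' : 0 ≤ M' := (norm_nonneg _).trans (hM' 0 (Set.mem_univ _))
    set K := M' * (v t - v 0) + M * (w t - w 0) + 1 with hK
    have hKpos : 0 < K := by positivity
    have hη : 0 < ε / K := by positivity
    obtain ⟨δ₁, hδ₁, Ha⟩ := exists_modulus ha hη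
    obtain ⟨δ₂, hδ₂, Hb⟩ := exists_modulus hb hη
    obtain ⟨k₀, hk₀⟩ := eventually_atTop.1 (eventually_one_div_lt (lt_min hδ₁ hδ₂))
    refine ⟨k₀, fun k hk => ?_⟩
    have hmesh : ∀ i, (u k (i + 1) : ℝ) - u k i < min δ₁ δ₂ := fun i =>
      (min_unifPt_sub_le k i t).trans_lt (hk₀ k hk.le)
    have eA : A t * C t = ∑ i ∈ range (k + 1),
        (A (u k (i + 1)) * C (u k (i + 1)) - A (u k i) * C (u k i)) := by
      rw [sum_range_sub (fun i => A (u k i) * C (u k i)), hu0, hu1, hA0, zero_mul, sub_zero]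
    have ev : v t - v 0 = ∑ i ∈ range (k + 1), (v (u k (i + 1)) - v (u k i)) := by
      rw [sum_range_sub (fun i => v (u k i)), hu0, hu1]
    have ew : w t - w 0 = ∑ i ∈ range (k + 1), (w (u k (i + 1)) - w (u k i)) := by
      rw [sum_range_sub (fun i => w (u k i)), hu0, hu1]
    rw [dist_zero_right, eA, ← sum_add_distrib, ← sum_sub_distrib]
    have hle : ‖∑ i ∈ range (k + 1), (A (u k (i + 1)) * C (u k (i + 1)) - A (u k i) * C (u k i) -
        (a (u k i) * C (u k i) * (α (u k (i + 1)) - α (u k i)) +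
          b (u k (i + 1)) * A (u k (i + 1)) * (β (u k (i + 1)) - β (u k i))))‖
        ≤ ε / K * M' * (v t - v 0) + ε / K * M * (w t - w 0) := by
      rw [ev, ew, mul_sum, mul_sum, ← sum_add_distrib]
      -- On a cell, the increment of `A` is `a` times that of `α` and the increment of `C` is `b`
      -- times that of `β`, up to errors that sum to a small multiple of the total variations.
      refine norm_sum_le_of_le _ fun i _ => ?_
      have h1 := norm_integral_sub_le B hv hη.le Ha le_rfl (hule k i)
        ((hmesh i).trans_le (min_le_left _ _)) (hA _) (hA _)
      have h2 := norm_integral_sub_le B hw hη.le Hb (hule k i) le_rfl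
        ((hmesh i).trans_le (min_le_right _ _)) (hC _) (hC _)
      have dv : 0 ≤ v (u k (i + 1)) - v (u k i) := sub_nonneg.2 (hv.mono (hule k i))
      have dw : 0 ≤ w (u k (i + 1)) - w (u k i) := sub_nonneg.2 (hw.mono (hule k i))
      have h1' := h1.trans (mul_le_mul_of_nonneg_right
        (mul_le_mul_of_nonneg_right hB1 hη.le) dv)
      have h2' := h2.trans (mul_le_mul_of_nonneg_right
        (mul_le_mul_of_nonneg_right hB1 hη.le) dw)
      have h3 := mul_le_mul h1' (hM' (u k i) (Set.mem_univ _)) (norm_nonneg _)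
        (by positivity)
      have h4 := mul_le_mul h2' (hM (u k (i + 1)) (Set.mem_univ _)) (norm_nonneg _)
        (by positivity)
      rw [← norm_mul] at h3 h4
      simp only [hB, ContinuousLinearMap.mul_apply'] at h3 h4
      refine le_trans (le_of_eq ?_) ((norm_add_le _ _).trans ((add_le_add h3 h4).trans
        (le_of_eq ?_)))
      · congr 1; ring
      · ring
    refine hle.trans_lt ?_
    calc ε / K * M' * (v t - v 0) + ε / K * M * (w t - w 0) = (K - 1) * (ε / K) := by
          rw [hK]; ring
      _ < K * (ε / K) := by gcongr; linarith
      _ = ε := by field_simp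
  have := tendsto_nhds_unique hlim' (hlim.const_sub (A t * C t))
  linarith

/-! ### Existence and continuity of the iterated integrals -/

/-- The variation of `g` on `[0, t]` as a function of `t`. -/
def varFn {F : Type*} [NormedAddCommGroup F] (g : unitInterval → F) (t : unitInterval) : ℝ :=
  (eVariationOn g (Set.Icc 0 t)).toReal

section varFn

variable {F : Type*} [NormedAddCommGroup F]

theorem varFn_nonneg (g : unitInterval → F) (t : unitInterval) : 0 ≤ varFn g t :=
  ENNReal.toReal_nonneg

theorem varFn_one (g : unitInterval → F) : varFn g 1 = (eVariationOn g Set.univ).toReal := by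
  rw [varFn]
  congr 2
  ext t
  simp [unitInterval.le_one']

theorem controls_varFn {g : unitInterval → F} (hg : eVariationOn g Set.univ ≠ ⊤) :
    Controls (varFn g) g := by
  intro a b hab
  have hfin : ∀ s : Set unitInterval, eVariationOn g s ≠ ⊤ := fun s =>
    ne_top_of_le_ne_top hg (eVariationOn.mono _ (Set.subset_univ s))
  have e := eVariationOn.Icc_add_Icc g (s := Set.univ)
    (unitInterval.nonneg' (t := a)) hab (Set.mem_univ _)
  simp only [Set.univ_inter] at e
  have d : edist (g b) (g a) ≤ eVariationOn g (Set.Icc a b) :=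
    eVariationOn.edist_le _ (Set.right_mem_Icc.2 hab) (Set.left_mem_Icc.2 hab)
  have d' := ENNReal.toReal_mono (hfin _) d
  rw [edist_dist, ENNReal.toReal_ofReal dist_nonneg, dist_eq_norm] at d'
  rw [varFn, varFn, ← e, ENNReal.toReal_add (hfin _) (hfin _)]
  linarith

theorem Controls.add_left {v w : unitInterval → ℝ} {g : unitInterval → F} (hv : Controls v g)
    (hw : Monotone w) : Controls (fun t => v t + w t) g := fun a b hab => by
  have := hv a b hab
  have := hw hab
  linarith

theorem Controls.clm_comp {G : Type*} [NormedAddCommGroup G] [NormedSpace ℝ F] [NormedSpace ℝ G]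
    {v : unitInterval → ℝ} {g : unitInterval → F} (hv : Controls v g) (f : F →L[ℝ] G) :
    Controls (fun t => ‖f‖ * v t) (fun t => f (g t)) := fun a b hab => by
  rw [← map_sub, ← mul_sub]
  exact (f.le_opNorm _).trans (mul_le_mul_of_nonneg_left (hv a b hab) (norm_nonneg _))

theorem varFn_one_le (x y : BVPath F) : varFn y 1 ≤ varFn x 1 + dist x y := by
  have h := BVPath.eVariationOn_add_le (f := x) (g := fun t => y t - x t)
  simp only [add_sub_cancel] at h
  have h' := ENNReal.toReal_mono
    (ENNReal.add_ne_top.2 ⟨x.boundedVariation, BVPath.variation_sub_ne_top y x⟩) h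
  rw [ENNReal.toReal_add x.boundedVariation (BVPath.variation_sub_ne_top y x)] at h'
  rw [varFn_one, varFn_one, dist_comm]
  exact h'

end varFn

/-! ### Tensor multiplication as a bounded bilinear map, and the iterated integrals -/

section Tensor

variable {W : Type u} [NormedAddCommGroup W] [NormedSpace ℝ W]

theorem tprod_one_add (w w' : W) : (PiTensorProduct.tprod ℝ fun _ : Fin 1 => w + w')
    = (PiTensorProduct.tprod ℝ fun _ : Fin 1 => w) + PiTensorProduct.tprod ℝ fun _ : Fin 1 => w' := by
  rw [← PiTensorProduct.subsingletonEquiv_symm_apply' (0 : Fin 1), map_add]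
  simp only [PiTensorProduct.subsingletonEquiv_symm_apply']

theorem tprod_one_smul (r : ℝ) (w : W) : (PiTensorProduct.tprod ℝ fun _ : Fin 1 => r • w)
    = r • PiTensorProduct.tprod ℝ fun _ : Fin 1 => w := by
  rw [← PiTensorProduct.subsingletonEquiv_symm_apply' (0 : Fin 1), map_smul]
  simp only [PiTensorProduct.subsingletonEquiv_symm_apply']

variable (N : AdmissibleTensorNorms W)

theorem mulRight_apply (n : ℕ) (w : W) (ξ : AlgTensor N n) :
    AlgTensor.mulRight (N := N) w ξ = (TensorPower.mulEquiv
      ((ξ : ⨂[ℝ]^n W) ⊗ₜ[ℝ] PiTensorProduct.tprod ℝ fun _ : Fin 1 => w) : ⨂[ℝ]^(n + 1) W) := rfl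

theorem tensorRight_coe (n : ℕ) (ξ : AlgTensor N n) (w : W) :
    tensorRight N n (ξ : BanachTensor N n) w = ((AlgTensor.mulRight (N := N) w ξ :
      AlgTensor N (n + 1)) : BanachTensor N (n + 1)) := by
  simp [tensorRight]

theorem tensorRight_add (n : ℕ) (ξ : BanachTensor N n) (w w' : W) :
    tensorRight N n ξ (w + w') = tensorRight N n ξ w + tensorRight N n ξ w' := by
  have h : AlgTensor.mulRight (N := N) (n := n) (w + w')
      = AlgTensor.mulRight w + AlgTensor.mulRight w' := by
    ext ξ
    simp only [add_apply]
    erw [mulRight_apply, mulRight_apply, mulRight_apply, tprod_one_add, TensorProduct.tmul_add,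
      map_add]
    rfl
  induction ξ using UniformSpace.Completion.induction_on with
  | hp =>
    refine isClosed_eq (ContinuousLinearMap.continuous _) ?_
    exact (ContinuousLinearMap.continuous _).add (ContinuousLinearMap.continuous _)
  | ih ξ =>
    rw [tensorRight_coe, tensorRight_coe, tensorRight_coe, h, add_apply,
      UniformSpace.Completion.coe_add]

theorem tensorRight_smul (n : ℕ) (ξ : BanachTensor N n) (r : ℝ) (w : W) :
    tensorRight N n ξ (r • w) = r • tensorRight N n ξ w := by
  have h : AlgTensor.mulRight (N := N) (n := n) (r • w) = r • AlgTensor.mulRight w := by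
    ext ξ
    simp only [smul_apply]
    erw [mulRight_apply, mulRight_apply, tprod_one_smul, TensorProduct.tmul_smul, map_smul]
    rfl
  induction ξ using UniformSpace.Completion.induction_on with
  | hp =>
    refine isClosed_eq (ContinuousLinearMap.continuous _) ?_
    exact (ContinuousLinearMap.continuous _).const_smul r
  | ih ξ =>
    rw [tensorRight_coe, tensorRight_coe, h, smul_apply,
      UniformSpace.Completion.coe_smul]

/-- `(ξ, w) ↦ ξ ⊗ w` as a bounded bilinear map. -/
def tensorRightL (n : ℕ) : BanachTensor N n →L[ℝ] W →L[ℝ] BanachTensor N (n + 1) :=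
  LinearMap.mkContinuous₂ (LinearMap.mk₂ ℝ (tensorRight N n)
    (fun ξ η w => map_add ((AlgTensor.mulRight (N := N) (n := n) w).completion) ξ η)
    (fun r ξ w => map_smul ((AlgTensor.mulRight (N := N) (n := n) w).completion) r ξ)
    (tensorRight_add N n) (fun r ξ w => tensorRight_smul N n ξ r w)) 1
    (fun ξ w => by rw [one_mul]; exact norm_tensorRight_le N n ξ w)

theorem tensorRightL_apply (n : ℕ) (ξ : BanachTensor N n) (w : W) :
    tensorRightL N n ξ w = tensorRight N n ξ w := rfl

/-- `rsIntegral` has the default value `0`, so its defining property is available only after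
existence is known. Continuity at level `m` gives existence at level `m + 1`, which in turn gives
continuity there; the induction alternates between the two. -/
theorem hasRSIntegral_iteratedIntegral_of_continuous (x : BVPath W) (m : ℕ)
    (h : Continuous (iteratedIntegral N x m)) (t : unitInterval) :
    HasRSIntegral (tensorRight N m) (iteratedIntegral N x m) x 0 t
      (iteratedIntegral N x (m + 1) t) := by
  have hex : ∃ J, HasRSIntegral (tensorRight N m) (iteratedIntegral N x m) x 0 t J :=
    exists_hasRSIntegral (tensorRightL N m) h (controls_varFn x.boundedVariation) t
  simp only [iteratedIntegral, rsIntegral]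
  rw [dif_pos hex]
  exact hex.choose_spec

theorem continuous_iteratedIntegral (x : BVPath W) (m : ℕ) :
    Continuous (iteratedIntegral N x m) := by
  induction m with
  | zero => exact continuous_const
  | succ m ih =>
    exact continuous_integral (tensorRightL N m) ih x.toMap.continuous
      (controls_varFn x.boundedVariation) (hasRSIntegral_iteratedIntegral_of_continuous N x m ih)

theorem hasRSIntegral_iteratedIntegral (x : BVPath W) (m : ℕ) (t : unitInterval) :
    HasRSIntegral (tensorRight N m) (iteratedIntegral N x m) x 0 t
      (iteratedIntegral N x (m + 1) t) :=
  hasRSIntegral_iteratedIntegral_of_continuous N x m (continuous_iteratedIntegral N x m) t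

/-! ### Continuity of the signature -/

/-- Pairing the integrands and the integrators makes the difference of two integrals a single
Riemann–Stieltjes integral, to which `HasRSIntegral.norm_le` applies. -/
theorem HasRSIntegral.prod_sub {E E' F F' G : Type*} [NormedAddCommGroup F]
    [NormedAddCommGroup F'] [NormedAddCommGroup G] {mul : E → F → G} {mul' : E' → F' → G}
    {f : unitInterval → E} {g : unitInterval → F} {f' : unitInterval → E'}
    {g' : unitInterval → F'} {a b : unitInterval} {J J' : G} (h : HasRSIntegral mul f g a b J)
    (h' : HasRSIntegral mul' f' g' a b J') :
    HasRSIntegral (fun (p : E × E') (q : F × F') => mul p.1 q.1 - mul' p.2 q.2)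
      (fun s => (f s, f' s)) (fun s => (g s, g' s)) a b (J - J') := by
  intro ε hε
  obtain ⟨δ, hδ, H⟩ := h (ε / 2) (by positivity)
  obtain ⟨δ', hδ', H'⟩ := h' (ε / 2) (by positivity)
  refine ⟨min δ δ', lt_min hδ hδ', fun n t s h0 hn ht => ?_⟩
  have h1 := H n t s h0 hn fun i hi =>
    ⟨(ht i hi).1, (ht i hi).2.1, (ht i hi).2.2.trans_le (min_le_left _ _)⟩
  have h2 := H' n t s h0 hn fun i hi =>
    ⟨(ht i hi).1, (ht i hi).2.1, (ht i hi).2.2.trans_le (min_le_right _ _)⟩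
  simp only [Prod.fst_sub, Prod.snd_sub, sum_sub_distrib]
  rw [sub_sub_sub_comm]
  refine (norm_sub_le _ _).trans_lt ?_
  linarith

/-- Iterated integrals of nearby paths are close. -/
theorem norm_iteratedIntegral_sub_le (x y : BVPath W) {v ω : unitInterval → ℝ}
    (hx : Controls v x) (hyv : ∀ t, varFn y t ≤ v t)
    (hω : Controls ω (fun t => x t - y t)) (hω0 : ∀ t, 0 ≤ ω t) (m : ℕ) (t : unitInterval) :
    ‖iteratedIntegral N x (m + 1) t - iteratedIntegral N y (m + 1) t‖
      ≤ ω t * v t ^ m / (m.factorial : ℝ) := by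
  have hv0 : ∀ t, 0 ≤ v t := fun t => (varFn_nonneg y t).trans (hyv t)
  have hY : ∀ m t, ‖iteratedIntegral N y m t‖ ≤ v t ^ m / (m.factorial : ℝ) := fun m t => by
    refine (norm_iteratedIntegral_le N y m t).trans ?_
    have := hyv t
    have h0 := varFn_nonneg y t
    rw [varFn] at this h0
    gcongr
  -- This is the splitting `X dx - Y dy = (X - Y) dx + Y d(x - y)`.
  have step : ∀ (m : ℕ) (u u' : unitInterval),
      ‖tensorRight N m (iteratedIntegral N x m u) (x u' - x u)
        - tensorRight N m (iteratedIntegral N y m u) (y u' - y u)‖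
      ≤ ‖iteratedIntegral N x m u - iteratedIntegral N y m u‖ * ‖x u' - x u‖
        + v u ^ m / (m.factorial : ℝ) * ‖(x u' - y u') - (x u - y u)‖ := by
    intro m u u'
    have e : tensorRight N m (iteratedIntegral N x m u) (x u' - x u)
        - tensorRight N m (iteratedIntegral N y m u) (y u' - y u)
        = tensorRight N m (iteratedIntegral N x m u - iteratedIntegral N y m u) (x u' - x u)
          + tensorRight N m (iteratedIntegral N y m u) ((x u' - y u') - (x u - y u)) := by
      simp only [← tensorRightL_apply, map_sub, sub_apply]
      abel
    rw [e]
    refine (norm_add_le _ _).trans (add_le_add (norm_tensorRight_le N m _ _) ?_)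
    exact (norm_tensorRight_le N m _ _).trans (mul_le_mul_of_nonneg_right (hY m u) (norm_nonneg _))
  induction m generalizing t with
  | zero =>
    refine ((hasRSIntegral_iteratedIntegral N x 0 t).prod_sub
      (hasRSIntegral_iteratedIntegral N y 0 t)).norm_le fun n u hu h0 hn => ?_
    calc _ ≤ ∑ i ∈ range n, (ω (u (i + 1)) - ω (u i)) := by
          refine norm_sum_le_of_le _ fun i _ => (step 0 _ _).trans ?_
          have := hω _ _ (hu (Nat.le_succ i))
          simpa [iteratedIntegral] using this
      _ = ω t - ω 0 := by rw [sum_range_sub (fun i => ω (u i)), h0, hn]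
      _ ≤ _ := by simpa using hω0 0
  | succ m ih =>
    refine ((hasRSIntegral_iteratedIntegral N x (m + 1) t).prod_sub
      (hasRSIntegral_iteratedIntegral N y (m + 1) t)).norm_le fun n u hu h0 hn => ?_
    -- Each term is dominated by an increment of `ω v^(m+1) / (m+1)!`, by the discrete product rule:
    -- `pow_mul_sub_le` bounds the part with the increment of `v`, and monotonicity of `v` the part
    -- with the increment of `ω`.
    calc _ ≤ ∑ i ∈ range n, (ω (u (i + 1)) * v (u (i + 1)) ^ (m + 1) / ((m + 1).factorial : ℝ)
            - ω (u i) * v (u i) ^ (m + 1) / ((m + 1).factorial : ℝ)) := by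
          refine norm_sum_le_of_le _ fun i _ => (step (m + 1) _ _).trans ?_
          have hle := hu (Nat.le_succ i)
          have h1 := hω _ _ hle
          have h2 := hx _ _ hle
          have h3 := hx.mono hle
          have h3' := hω.mono hle
          have h4 := pow_mul_sub_le (hv0 (u i)) h3 m
          have h5 := ih (u i)
          have hf : (0 : ℝ) < m.factorial := by exact_mod_cast m.factorial_pos
          have hf' : ((m + 1).factorial : ℝ) = (m + 1) * m.factorial := by
            rw [Nat.factorial_succ]; push_cast; ring
          have h6 : v (u i) ^ (m + 1) ≤ v (u (i + 1)) ^ (m + 1) := pow_le_pow_left₀ (hv0 _) h3 _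
          have h7 := mul_le_mul_of_nonneg_left h4 (hω0 (u i))
          have h8 := mul_le_mul_of_nonneg_left h6 (sub_nonneg.2 h3')
          calc _ ≤ ω (u i) * v (u i) ^ m / (m.factorial : ℝ) * (v (u (i + 1)) - v (u i))
                + v (u i) ^ (m + 1) / ((m + 1).factorial : ℝ) * (ω (u (i + 1)) - ω (u i)) := by
                refine add_le_add (mul_le_mul h5 h2 (norm_nonneg _) ((norm_nonneg _).trans h5))
                  (mul_le_mul_of_nonneg_left h1 ?_)
                exact div_nonneg (pow_nonneg (hv0 _) _) (by positivity)
            _ = (ω (u i) * ((m + 1) * (v (u i) ^ m * (v (u (i + 1)) - v (u i))))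
                + (ω (u (i + 1)) - ω (u i)) * v (u i) ^ (m + 1)) / ((m + 1).factorial : ℝ) := by
                rw [hf']; field_simp
            _ ≤ _ := by
                rw [← sub_div]
                gcongr
                linarith
      _ = ω t * v t ^ (m + 1) / ((m + 1).factorial : ℝ)
            - ω 0 * v 0 ^ (m + 1) / ((m + 1).factorial : ℝ) := by
          rw [sum_range_sub (fun i => ω (u i) * v (u i) ^ (m + 1) / ((m + 1).factorial : ℝ)),
            h0, hn]
      _ ≤ _ := sub_le_self _ (div_nonneg (mul_nonneg (hω0 _) (pow_nonneg (hv0 _) _))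
          (by positivity))

/-- Level `0` cancels, the bounds on the other levels sum to an exponential, and the `ℓ²` norm is at
most the `ℓ¹` norm. -/
theorem norm_signature_sub_le (x y : BVPath W) :
    ‖(signature N x : TensorSeries N) - signature N y‖
      ≤ dist x y * Real.exp (varFn x 1 + varFn y 1) := by
  set L := varFn x 1 + varFn y 1 with hL
  have hL0 : 0 ≤ L := add_nonneg (varFn_nonneg _ _) (varFn_nonneg _ _)
  have hxc := controls_varFn x.boundedVariation
  have hyc := controls_varFn y.boundedVariation
  have hd : dist x y = varFn (fun t => x t - y t) 1 := (varFn_one _).symm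
  have hbound : ∀ m, ‖((signature N x : TensorSeries N) - signature N y) (m + 1)‖
      ≤ dist x y * (L ^ m / m.factorial) := by
    intro m
    rw [hd, ← mul_div_assoc]
    exact norm_iteratedIntegral_sub_le N x y (hxc.add_left hyc.mono)
      (fun t => le_add_of_nonneg_left (varFn_nonneg x t))
      (controls_varFn (BVPath.variation_sub_ne_top x y)) (varFn_nonneg _) m 1
  have hzero : ((signature N x : TensorSeries N) - signature N y) 0 = 0 :=
    sub_self (tensorUnit N)
  set b : ℕ → ℝ := fun m => ‖((signature N x : TensorSeries N) - signature N y) m‖ with hb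
  have hsum : ∀ s : Finset ℕ, ∑ i ∈ s, b i ≤ dist x y * Real.exp L := by
    intro s
    obtain ⟨n, hn⟩ : ∃ n, s ⊆ range (n + 1) := by
      obtain ⟨n, hn⟩ := s.exists_nat_subset_range
      exact ⟨n, hn.trans (range_mono (Nat.le_succ n))⟩
    calc ∑ i ∈ s, b i ≤ ∑ i ∈ range (n + 1), b i :=
          sum_le_sum_of_subset_of_nonneg hn fun i _ _ => norm_nonneg _
      _ = ∑ i ∈ range n, b (i + 1) := by
          rw [sum_range_succ', hb]; simp only [hzero, norm_zero, add_zero]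
      _ ≤ ∑ i ∈ range n, dist x y * (L ^ i / i.factorial) := sum_le_sum fun i _ => hbound i
      _ = dist x y * ∑ i ∈ range n, L ^ i / i.factorial := (mul_sum _ _ _).symm
      _ ≤ _ := mul_le_mul_of_nonneg_left (Real.sum_le_exp_of_nonneg hL0 n) dist_nonneg
  refine lp.norm_le_of_forall_sum_le (by norm_num)
    (mul_nonneg dist_nonneg (Real.exp_nonneg _)) fun s => ?_
  have e : (2 : ENNReal).toReal = ((2 : ℕ) : ℝ) := by simp
  simp only [e, Real.rpow_natCast]
  calc ∑ i ∈ s, b i ^ 2 ≤ (∑ i ∈ s, b i) ^ 2 := sum_sq_le_sq_sum_of_nonneg fun i _ => norm_nonneg _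
    _ ≤ _ := pow_le_pow_left₀ (sum_nonneg fun i _ => norm_nonneg _) (hsum s) 2

/-- The length of `y` is at most that of `x` plus their distance, so the exponential factor stays
bounded near `x`. -/
theorem continuous_signature : Continuous (signature N) := by
  rw [continuous_iff_continuousAt]
  intro x
  rw [ContinuousAt, tendsto_subtype_rng, tendsto_iff_norm_sub_tendsto_zero]
  have hlim : Tendsto (fun y : BVPath W =>
      dist y x * Real.exp (varFn x 1 + dist x y + varFn x 1)) (𝓝 x) (𝓝 0) := by
    have : Continuous fun y : BVPath W =>
        dist y x * Real.exp (varFn x 1 + dist x y + varFn x 1) := by fun_prop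
    simpa using this.tendsto x
  refine squeeze_zero (fun _ => norm_nonneg _) (fun y => ?_) hlim
  refine (norm_signature_sub_le N y x).trans ?_
  have := varFn_one_le x y
  gcongr

end Tensor

/-! ### Continuity of the time augmentation -/

section TimeAugment

variable {V : Type*} {W : Type u} [NormedAddCommGroup V] [NormedSpace ℝ V] [NormedAddCommGroup W]
  [NormedSpace ℝ W]

/-- Time cancels in the difference of two augmented paths, so the map is Lipschitz, with the norm of
`v ↦ e (v, 0)` as constant. -/
theorem continuous_timeAugment (e : (V × ℝ) ≃L[ℝ] W) :
    Continuous (BVPath.timeAugment (V := V) e) := by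
  have hlip : LipschitzWith ‖(e : (V × ℝ) →L[ℝ] W).comp (ContinuousLinearMap.inl ℝ V ℝ)‖₊
      (BVPath.timeAugment (V := V) e) := by
    refine LipschitzWith.of_dist_le_mul fun x y => ?_
    set f := (e : (V × ℝ) →L[ℝ] W).comp (ContinuousLinearMap.inl ℝ V ℝ) with hf
    have h : (fun t => x.timeAugment e t - y.timeAugment e t) = fun t => f (x t - y t) := by
      ext t
      change e (x t, (t : ℝ)) - e (y t, (t : ℝ)) = e (x t - y t, 0)
      rw [← map_sub]; simp
    change (eVariationOn (fun t => x.timeAugment e t - y.timeAugment e t) Set.univ).toReal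
      ≤ ‖f‖₊ * (eVariationOn (fun t => x t - y t) Set.univ).toReal
    rw [h]
    have h2 := (f.lipschitz.lipschitzOnWith (s := Set.univ)).comp_eVariationOn_le
      (Set.mapsTo_univ (fun t => x t - y t) Set.univ)
    have h3 := ENNReal.toReal_mono
      (ENNReal.mul_ne_top ENNReal.coe_ne_top (BVPath.variation_sub_ne_top x y)) h2
    rw [ENNReal.toReal_mul] at h3
    exact h3
  exact hlip.continuous

theorem continuous_normalizedSignature (e : (V × ℝ) ≃L[ℝ] W) (N : AdmissibleTensorNorms W)
    {Λ : TensorSeriesOne N → TensorSeriesOne N} (hΛ : Continuous Λ) :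
    Continuous (normalizedSignature e N Λ) :=
  continuous_subtype_val.comp
    (hΛ.comp ((continuous_signature N).comp (continuous_timeAugment e)))

end TimeAugment

/-! ### Word functionals -/

section Words

variable {W : Type u} [NormedAddCommGroup W] [NormedSpace ℝ W]

/-- The algebraic functional `fₙ ⊗ ⋯ ⊗ f₁` on `W^{⊗ n}` given by the word `[f₁, …, fₙ]`; the head
of the list acts on the last factor. -/
def wordFunAlg : (w : List (W →L[ℝ] ℝ)) → (⨂[ℝ]^w.length W →ₗ[ℝ] ℝ)
  | [] => (PiTensorProduct.isEmptyEquiv (R := ℝ) (s := fun _ : Fin 0 => W) (Fin 0)).toLinearMap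
  | f :: w => (LinearMap.mul' ℝ ℝ ∘ₗ TensorProduct.map (wordFunAlg w)
      ((f : W →ₗ[ℝ] ℝ) ∘ₗ (PiTensorProduct.subsingletonEquiv (R := ℝ) (s := fun _ : Fin 1 => W)
        (0 : Fin 1)).toLinearMap)) ∘ₗ
      (TensorPower.mulEquiv (R := ℝ) (M := W) (n := w.length) (m := 1)).symm.toLinearMap

theorem wordFunAlg_cons (f : W →L[ℝ] ℝ) (w : List (W →L[ℝ] ℝ)) (ξ : ⨂[ℝ]^w.length W) (v : W) :
    wordFunAlg (f :: w) (TensorPower.mulEquiv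
      (ξ ⊗ₜ[ℝ] PiTensorProduct.tprod ℝ fun _ : Fin 1 => v) : ⨂[ℝ]^(w.length + 1) W)
      = wordFunAlg w ξ * f v := by
  simp only [wordFunAlg, LinearMap.comp_apply, LinearEquiv.coe_coe]
  erw [LinearEquiv.symm_apply_apply]
  simp only [TensorProduct.map_tmul, LinearMap.mul'_apply, LinearMap.comp_apply,
    LinearEquiv.coe_coe, PiTensorProduct.subsingletonEquiv_apply_tprod]
  rfl

/-- Each letter adds a tensor factor, and the admissibility axiom `bounded_mul` preserves
boundedness. The empty word is the identification of `W^{⊗ 0}` with `ℝ`, where the norm is the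
absolute value. -/
theorem wordFunAlg_bounded (N : AdmissibleTensorNorms W) (w : List (W →L[ℝ] ℝ)) :
    ∃ C : ℝ, ∀ ξ, |wordFunAlg w ξ| ≤ C * N.nrm w.length ξ := by
  induction w with
  | nil =>
    refine ⟨1, fun ξ => ?_⟩
    obtain ⟨r, rfl⟩ := (PiTensorProduct.isEmptyEquiv (R := ℝ) (s := fun _ : Fin 0 => W)
      (Fin 0)).symm.surjective ξ
    have h1 : wordFunAlg ([] : List (W →L[ℝ] ℝ)) ((PiTensorProduct.isEmptyEquiv (R := ℝ)
      (s := fun _ : Fin 0 => W) (Fin 0)).symm r) = r := LinearEquiv.apply_symm_apply _ r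
    have h2 : (PiTensorProduct.isEmptyEquiv (R := ℝ) (s := fun _ : Fin 0 => W) (Fin 0)).symm r
        = r • (PiTensorProduct.tprod ℝ Fin.elim0 : ⨂[ℝ]^0 W) := by
      rw [PiTensorProduct.isEmptyEquiv_symm_apply]
      congr 2
    have h3 : N.nrm 0 (r • (PiTensorProduct.tprod ℝ Fin.elim0 : ⨂[ℝ]^0 W)) = |r| := by
      rw [map_smul_eq_mul, N.nrm_unit, mul_one, Real.norm_eq_abs]
    rw [h1, h2, one_mul]
    exact h3.ge
  | cons f w ih =>
    refine N.bounded_mul w.length 1 (wordFunAlg w) _ ih ⟨‖f‖, fun η => ?_⟩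
    obtain ⟨v, rfl⟩ := (PiTensorProduct.subsingletonEquiv (R := ℝ) (s := fun _ : Fin 1 => W)
      (0 : Fin 1)).symm.surjective η
    rw [PiTensorProduct.subsingletonEquiv_symm_apply', N.nrm_one]
    simp only [LinearMap.comp_apply, LinearEquiv.coe_coe,
      PiTensorProduct.subsingletonEquiv_apply_tprod]
    exact f.le_opNorm v

variable (N : AdmissibleTensorNorms W)

/-- The bounded functional on the normed algebraic tensor power given by a word. -/
def wordFunNormed (w : List (W →L[ℝ] ℝ)) : AlgTensor N w.length →L[ℝ] ℝ :=
  LinearMap.mkContinuousOfExistsBound (E := AlgTensor N w.length) (wordFunAlg w)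
    (wordFunAlg_bounded N w)

theorem wordFunNormed_apply (w : List (W →L[ℝ] ℝ)) (ξ : AlgTensor N w.length) :
    wordFunNormed N w ξ = wordFunAlg w ξ := rfl

/-- The bounded functional on the completed tensor power given by a word. -/
def wordFun (w : List (W →L[ℝ] ℝ)) : BanachTensor N w.length →L[ℝ] ℝ :=
  (wordFunNormed N w).extend
    (UniformSpace.Completion.toComplL (𝕜 := ℝ) (E := AlgTensor N w.length))

theorem wordFun_coe (w : List (W →L[ℝ] ℝ)) (ξ : AlgTensor N w.length) :
    wordFun N w (ξ : BanachTensor N w.length) = wordFunNormed N w ξ :=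
  ContinuousLinearMap.extend_eq (wordFunNormed N w)
    (e := UniformSpace.Completion.toComplL (𝕜 := ℝ) (E := AlgTensor N w.length))
    UniformSpace.Completion.denseRange_coe
    (UniformSpace.Completion.isUniformInducing_coe (AlgTensor N w.length)) ξ

theorem wordFun_nil : wordFun N [] (tensorUnit N) = 1 :=
  (wordFun_coe N [] (AlgTensor.unit N)).trans (PiTensorProduct.isEmptyEquiv_apply_tprod _ _)

theorem wordFun_cons (f : W →L[ℝ] ℝ) (w : List (W →L[ℝ] ℝ)) (ξ : BanachTensor N w.length)
    (v : W) : wordFun N (f :: w) (tensorRight N w.length ξ v) = wordFun N w ξ * f v := by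
  induction ξ using UniformSpace.Completion.induction_on with
  | hp =>
    refine isClosed_eq ((wordFun N (f :: w)).continuous.comp ?_)
      ((wordFun N w).continuous.mul continuous_const)
    exact ((AlgTensor.mulRight (N := N) (n := w.length) v).completion).continuous
  | ih ξ =>
    rw [tensorRight_coe, wordFun_coe N (f :: w), wordFun_coe, wordFunNormed_apply,
      wordFunNormed_apply]
    exact wordFunAlg_cons f w ξ v

/-! ### The algebra of scalar iterated integrals -/

/-- The scalar iterated integral of a path given by a word, as a function of path and time. -/
def wordIntegral (w : List (W →L[ℝ] ℝ)) : BVPath W → unitInterval → ℝ :=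
  fun x t => wordFun N w (iteratedIntegral N x w.length t)

theorem wordIntegral_nil : wordIntegral N [] = 1 := by
  ext x t
  exact wordFun_nil N

theorem continuous_wordIntegral (w : List (W →L[ℝ] ℝ)) (x : BVPath W) :
    Continuous (wordIntegral N w x) :=
  (wordFun N w).continuous.comp (continuous_iteratedIntegral N x w.length)

theorem hasRSIntegral_wordIntegral (f : W →L[ℝ] ℝ) (w : List (W →L[ℝ] ℝ)) (x : BVPath W)
    (t : unitInterval) : HasRSIntegral (· * ·) (wordIntegral N w x) (fun s => f (x s)) 0 t
      (wordIntegral N (f :: w) x t) := by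
  intro ε hε
  set φ := wordFun N (f :: w) with hφ
  obtain ⟨δ, hδ, H⟩ := hasRSIntegral_iteratedIntegral N x w.length t (ε / (‖φ‖ + 1))
    (by positivity)
  refine ⟨δ, hδ, fun n u s h0 hn hu => ?_⟩
  have e : ∑ i ∈ range n, wordIntegral N w x (s i) * (f (x (u (i + 1))) - f (x (u i)))
      - wordIntegral N (f :: w) x t = φ (∑ i ∈ range n, tensorRight N w.length
        (iteratedIntegral N x w.length (s i)) (x (u (i + 1)) - x (u i))
          - iteratedIntegral N x (w.length + 1) t) := by
    rw [map_sub, map_sum]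
    congr 1
    refine sum_congr rfl fun i _ => ?_
    rw [hφ, wordFun_cons, map_sub]
    rfl
  rw [e]
  refine (φ.le_opNorm _).trans_lt ?_
  have h := (H n u s h0 hn hu).le
  calc _ ≤ ‖φ‖ * (ε / (‖φ‖ + 1)) := by gcongr
    _ < (‖φ‖ + 1) * (ε / (‖φ‖ + 1)) := by gcongr; linarith
    _ = ε := by field_simp

theorem wordIntegral_singleton (f : W →L[ℝ] ℝ) (x : BVPath W) (t : unitInterval) :
    wordIntegral N [f] x t = f (x t) := by
  have h := hasRSIntegral_wordIntegral N f [] x t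
  rw [wordIntegral_nil] at h
  refine tendsto_nhds_unique (h.tendsto_sum (fun k i => min (unifPt k i) t) (fun _ _ => le_rfl)
    (fun k i => min_unifPt_le k i t)) (tendsto_const_nhds.congr fun k => ?_)
  simp only [Pi.one_apply, one_mul]
  rw [sum_range_sub (fun i => f (x (min (unifPt k i) t))), unifPt_zero, unifPt_last,
    min_eq_right unitInterval.le_one', min_eq_left unitInterval.nonneg', x.map_zero, map_zero,
    sub_zero]

/-- The span of the scalar iterated integrals over words of length `n`. -/
def wordSpan (n : ℕ) : Submodule ℝ (BVPath W → unitInterval → ℝ) :=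
  Submodule.span ℝ {H | ∃ w : List (W →L[ℝ] ℝ), w.length = n ∧ wordIntegral N w = H}

variable {N}

theorem wordIntegral_mem {w : List (W →L[ℝ] ℝ)} {n : ℕ} (h : w.length = n) :
    wordIntegral N w ∈ wordSpan N n :=
  Submodule.subset_span ⟨w, h, rfl⟩

theorem HasRSIntegral.add_mul {f f' g : unitInterval → ℝ} {a b : unitInterval} {J J' : ℝ}
    (h : HasRSIntegral (· * ·) f g a b J) (h' : HasRSIntegral (· * ·) f' g a b J') :
    HasRSIntegral (· * ·) (f + f') g a b (J + J') := by
  intro ε hε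
  obtain ⟨δ, hδ, H⟩ := h (ε / 2) (by positivity)
  obtain ⟨δ', hδ', H'⟩ := h' (ε / 2) (by positivity)
  refine ⟨min δ δ', lt_min hδ hδ', fun n t s h0 hn ht => ?_⟩
  have h1 := H n t s h0 hn fun i hi =>
    ⟨(ht i hi).1, (ht i hi).2.1, (ht i hi).2.2.trans_le (min_le_left _ _)⟩
  have h2 := H' n t s h0 hn fun i hi =>
    ⟨(ht i hi).1, (ht i hi).2.1, (ht i hi).2.2.trans_le (min_le_right _ _)⟩
  simp only [Pi.add_apply, _root_.add_mul, sum_add_distrib]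
  rw [add_sub_add_comm]
  refine (norm_add_le _ _).trans_lt ?_
  linarith

theorem HasRSIntegral.smul_mul {f g : unitInterval → ℝ} {a b : unitInterval} {J : ℝ}
    (h : HasRSIntegral (· * ·) f g a b J) (r : ℝ) :
    HasRSIntegral (· * ·) (r • f) g a b (r • J) := by
  intro ε hε
  obtain ⟨δ, hδ, H⟩ := h (ε / (|r| + 1)) (by positivity)
  refine ⟨δ, hδ, fun n t s h0 hn ht => ?_⟩
  have h1 := (H n t s h0 hn ht).le
  simp only [Pi.smul_apply, smul_eq_mul, mul_assoc, ← mul_sum]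
  rw [← mul_sub, norm_mul, Real.norm_eq_abs r]
  calc _ ≤ |r| * (ε / (|r| + 1)) := by gcongr
    _ < (|r| + 1) * (ε / (|r| + 1)) := by gcongr; linarith
    _ = ε := by field_simp

theorem hasRSIntegral_zero_mul (g : unitInterval → ℝ) (a b : unitInterval) :
    HasRSIntegral (· * ·) (0 : unitInterval → ℝ) g a b 0 :=
  fun ε hε => ⟨1, one_pos, fun n t s _ _ _ => by simpa using hε⟩

/-- Integration against `f ∘ x` puts the letter `f` in front of each word. A single `K` serves all
paths and all times because the coefficients of the combination do not depend on them. -/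
theorem exists_integral_mem_wordSpan (f : W →L[ℝ] ℝ) {n : ℕ} {H : BVPath W → unitInterval → ℝ}
    (hH : H ∈ wordSpan N n) : ∃ K ∈ wordSpan N (n + 1), ∀ x t,
      HasRSIntegral (· * ·) (H x) (fun s => f (x s)) 0 t (K x t) := by
  induction hH using Submodule.span_induction with
  | mem H h =>
    obtain ⟨w, hw, rfl⟩ := h
    exact ⟨wordIntegral N (f :: w), wordIntegral_mem (by simp [hw]),
      hasRSIntegral_wordIntegral N f w⟩
  | zero => exact ⟨0, zero_mem _, fun x t => hasRSIntegral_zero_mul _ _ _⟩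
  | add H H' _ _ ih ih' =>
    obtain ⟨K, hK, h⟩ := ih
    obtain ⟨K', hK', h'⟩ := ih'
    exact ⟨K + K', add_mem hK hK', fun x t => (h x t).add_mul (h' x t)⟩
  | smul r H _ ih =>
    obtain ⟨K, hK, h⟩ := ih
    exact ⟨r • K, Submodule.smul_mem _ r hK, fun x t => (h x t).smul_mul r⟩

/-- The shuffle product: products of scalar iterated integrals are linear combinations of scalar
iterated integrals. -/
theorem wordIntegral_mul_mem (n : ℕ) (w w' : List (W →L[ℝ] ℝ)) (h : w.length + w'.length = n) :
    wordIntegral N w * wordIntegral N w' ∈ wordSpan N n := by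
  induction n generalizing w w' with
  | zero =>
    obtain rfl : w = [] := List.length_eq_zero_iff.1 (by omega)
    rw [wordIntegral_nil, one_mul]
    exact wordIntegral_mem (by simpa using h)
  | succ n ih =>
    cases w with
    | nil =>
      rw [wordIntegral_nil, one_mul]
      exact wordIntegral_mem (by simpa using h)
    | cons f u =>
      cases w' with
      | nil =>
        rw [wordIntegral_nil, mul_one]
        exact wordIntegral_mem (by simpa using h)
      | cons g v =>
        simp only [List.length_cons] at h
        -- Integration by parts splits the product of the integrals for `f :: u` and `g :: v`
        -- according to the last integrator. Both remaining integrands are products of total length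
        -- `n`.
        obtain ⟨K, hK, hK'⟩ := exists_integral_mem_wordSpan f
          (ih u (g :: v) (by simp only [List.length_cons]; omega))
        obtain ⟨L, hL, hL'⟩ := exists_integral_mem_wordSpan g
          (ih v (f :: u) (by simp only [List.length_cons]; omega))
        have e : wordIntegral N (f :: u) * wordIntegral N (g :: v) = K + L := by
          ext x t
          have hv := controls_varFn x.boundedVariation
          exact mul_integral_eq_add (continuous_wordIntegral N u x)
            (continuous_wordIntegral N v x) (f.continuous.comp x.toMap.continuous)
            (g.continuous.comp x.toMap.continuous) (hv.clm_comp f) (hv.clm_comp g)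
            (hasRSIntegral_wordIntegral N f u x) (hasRSIntegral_wordIntegral N g v x)
            (hK' x t) (hL' x t)
        rw [e]
        exact add_mem hK hL

theorem mul_mem_wordSpan {m n : ℕ} {H K : BVPath W → unitInterval → ℝ} (hH : H ∈ wordSpan N m)
    (hK : K ∈ wordSpan N n) : H * K ∈ wordSpan N (m + n) := by
  have h := Submodule.mul_mem_mul hH hK
  rw [wordSpan, wordSpan, Submodule.span_mul_span] at h
  refine Submodule.span_le.2 ?_ h
  rintro _ ⟨_, ⟨w, hw, rfl⟩, _, ⟨w', hw', rfl⟩, rfl⟩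
  exact wordIntegral_mul_mem _ w w' (by rw [hw, hw'])

/-! ### The iterated integrals of a path with a time coordinate determine it -/

/-- On each cell of a fine uniform partition, the term of the sum is the integral of a constant that
is uniformly close to `φ`. -/
theorem HasRSIntegral.eq_intervalIntegral {φ : unitInterval → ℝ} (hφ : Continuous φ) {J : ℝ}
    (h : HasRSIntegral (· * ·) φ (fun t => (t : ℝ)) 0 1 J) :
    J = ∫ s in (0 : ℝ)..1, Set.IccExtend zero_le_one φ s := by
  set ψ := Set.IccExtend (zero_le_one (α := ℝ)) φ with hψ
  have hψc : Continuous ψ := hφ.Icc_extend'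
  refine tendsto_nhds_unique (h.tendsto_sum (fun k i => min (unifPt k i) 1) (fun _ _ => le_rfl)
    (fun k i => min_unifPt_le k i 1)) ?_
  simp only [min_eq_left (unitInterval.le_one')]
  rw [Metric.tendsto_atTop']
  intro ε hε
  obtain ⟨δ, hδ, H⟩ := exists_modulus hφ (half_pos hε)
  obtain ⟨k₀, hk₀⟩ := eventually_atTop.1 (eventually_one_div_lt hδ)
  refine ⟨k₀, fun k hk => ?_⟩
  have e : ∫ s in (0 : ℝ)..1, ψ s
      = ∑ i ∈ range (k + 1), ∫ s in (unifPt k i : ℝ)..unifPt k (i + 1), ψ s := by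
    rw [intervalIntegral.sum_integral_adjacent_intervals (a := fun i => (unifPt k i : ℝ))
      (fun i _ => hψc.intervalIntegrable _ _), unifPt_zero, unifPt_last]
    simp
  have e1 : (1 : ℝ) = ∑ i ∈ range (k + 1), ((unifPt k (i + 1) : ℝ) - unifPt k i) := by
    rw [sum_range_sub (fun i => (unifPt k i : ℝ)), unifPt_zero, unifPt_last]; simp
  rw [dist_eq_norm, e, ← sum_sub_distrib]
  refine lt_of_le_of_lt (b := ε / 2 * 1) ?_ (by linarith)
  conv_rhs => rw [e1, mul_sum]
  refine norm_sum_le_of_le _ fun i _ => ?_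
  have hle : (unifPt k i : ℝ) ≤ unifPt k (i + 1) := unifPt_mono k (Nat.le_succ i)
  have e2 : φ (unifPt k i) * ((unifPt k (i + 1) : ℝ) - unifPt k i)
      = ∫ s in (unifPt k i : ℝ)..unifPt k (i + 1), φ (unifPt k i) := by
    rw [intervalIntegral.integral_const, smul_eq_mul, mul_comm]
  rw [e2, ← intervalIntegral.integral_sub (by simp) (hψc.intervalIntegrable _ _)]
  refine (intervalIntegral.norm_integral_le_of_norm_le_const (C := ε / 2) fun s hs => ?_).trans
    (le_of_eq (by rw [abs_of_nonneg (sub_nonneg.2 hle)]))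
  rw [Set.uIoc_of_le hle] at hs
  have hs01 : s ∈ Set.Icc (0 : ℝ) 1 :=
    ⟨(unifPt k i).2.1.trans hs.1.le, hs.2.trans (unifPt k (i + 1)).2.2⟩
  rw [hψ, Set.IccExtend_of_mem _ _ hs01]
  apply H
  have h3 := unifPt_sub_le k i
  have h4 := hk₀ k hk.le
  rw [abs_lt]
  constructor <;> linarith [hs.1, hs.2]

/-- A continuous function all of whose moments vanish is zero. -/
theorem eq_zero_of_moments_eq_zero {D : ℝ → ℝ} (hD : Continuous D)
    (h : ∀ k : ℕ, ∫ s in (0 : ℝ)..1, D s * s ^ k = 0) : ∀ s ∈ Set.Icc (0 : ℝ) 1, D s = 0 := by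
  have hpoly : ∀ p : Polynomial ℝ, ∫ s in (0 : ℝ)..1, D s * p.eval s = 0 := by
    intro p
    simp only [Polynomial.eval_eq_sum_range, mul_sum]
    rw [intervalIntegral.integral_finsetSum fun i _ =>
      Continuous.intervalIntegrable (by fun_prop) _ _]
    refine sum_eq_zero fun i _ => ?_
    have : ∀ s, D s * (p.coeff i * s ^ i) = p.coeff i * (D s * s ^ i) := fun s => by ring
    simp only [this, intervalIntegral.integral_const_mul, h i, mul_zero]
  obtain ⟨M, hM⟩ := isCompact_Icc.exists_bound_of_continuousOn
    (hD.continuousOn (s := Set.Icc (0 : ℝ) 1))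
  have hM0 : 0 ≤ M := (norm_nonneg _).trans (hM 0 (by simp))
  by_contra! hne
  obtain ⟨c, hc, hc0⟩ := hne
  have hpos : 0 < ∫ s in (0 : ℝ)..1, D s * D s :=
    intervalIntegral.integral_pos zero_lt_one (hD.mul hD).continuousOn
      (fun s _ => mul_self_nonneg _) ⟨c, hc, mul_self_pos.2 hc0⟩
  set I := ∫ s in (0 : ℝ)..1, D s * D s with hI
  -- `D` is orthogonal to all polynomials, so `∫ D² = ∫ D (D - p)`. A Weierstrass approximation `p`
  -- makes the right side at most `I / 2`, which contradicts `0 < I`.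
  obtain ⟨p, hp⟩ := exists_polynomial_near_of_continuousOn 0 1 D hD.continuousOn
    (I / (2 * (M + 1))) (by positivity)
  have e : I = ∫ s in (0 : ℝ)..1, D s * (D s - p.eval s) := by
    simp only [mul_sub]
    rw [intervalIntegral.integral_sub (Continuous.intervalIntegrable (by fun_prop) _ _)
      (Continuous.intervalIntegrable (by fun_prop) _ _), hpoly p, sub_zero]
  have hle := intervalIntegral.norm_integral_le_of_norm_le_const (a := 0) (b := 1)
    (f := fun s => D s * (D s - p.eval s)) (C := M * (I / (2 * (M + 1)))) fun s hs => by
      rw [Set.uIoc_of_le zero_le_one] at hs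
      have hs' := Set.Ioc_subset_Icc_self hs
      rw [norm_mul, norm_sub_rev]
      exact mul_le_mul (hM s hs') (hp s hs').le (norm_nonneg _) hM0
  rw [← e, Real.norm_of_nonneg hpos.le, sub_zero, abs_one, mul_one] at hle
  have : M * (I / (2 * (M + 1))) ≤ I / 2 := by
    calc M * (I / (2 * (M + 1))) ≤ (M + 1) * (I / (2 * (M + 1))) := by gcongr; linarith
      _ = I / 2 := by field_simp
  linarith

/-- A path with a time coordinate is determined by its scalar iterated integrals. -/
theorem eq_of_wordIntegral_eq {τ : W →L[ℝ] ℝ} {x y : BVPath W} (hx : ∀ t, τ (x t) = t)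
    (hy : ∀ t, τ (y t) = t) (h : ∀ w, wordIntegral N w x 1 = wordIntegral N w y 1) : x = y := by
  have hspan : ∀ {n : ℕ} {K : BVPath W → unitInterval → ℝ}, K ∈ wordSpan N n →
      K x 1 = K y 1 := by
    intro n K hK
    induction hK using Submodule.span_induction with
    | mem H hH => obtain ⟨w, -, rfl⟩ := hH; exact h w
    | zero => rfl
    | add H H' _ _ ih ih' => simp only [Pi.add_apply, ih, ih']
    | smul r H _ ih => simp only [Pi.smul_apply, ih]
  refine BVPath.ext' fun t => (SeparatingDual.eq_iff_forall_dual_eq (R := ℝ)).2 fun f => ?_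
  -- On a path with a time coordinate, this product is the function `f (x t) * t ^ k`. One further
  -- integration, against `τ`, gives its moment.
  have hpow : ∀ k : ℕ, wordIntegral N [f] * wordIntegral N [τ] ^ k ∈ wordSpan N (1 + k) := by
    intro k
    induction k with
    | zero => simpa using wordIntegral_mem (N := N) (w := [f]) rfl
    | succ k ih =>
      rw [pow_succ, ← mul_assoc]
      exact mul_mem_wordSpan (m := 1 + k) (n := 1) ih (wordIntegral_mem rfl)
  have hcont : ∀ z : BVPath W, Continuous fun t => f (z t) := fun z =>
    f.continuous.comp z.toMap.continuous
  have hmom : ∀ (k : ℕ) (z : BVPath W), (∀ t, τ (z t) = t) →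
      ∀ J, HasRSIntegral (· * ·) ((wordIntegral N [f] * wordIntegral N [τ] ^ k) z)
        (fun s => τ (z s)) 0 1 J →
      J = ∫ s in (0 : ℝ)..1, Set.IccExtend zero_le_one (fun t => f (z t)) s * s ^ k := by
    intro k z hz J hJ
    have e : (wordIntegral N [f] * wordIntegral N [τ] ^ k) z
        = fun t : unitInterval => f (z t) * (t : ℝ) ^ k := by
      ext t
      simp only [Pi.mul_apply, Pi.pow_apply, wordIntegral_singleton, hz]
    simp only [e, hz] at hJ
    rw [hJ.eq_intervalIntegral ((hcont z).mul (by fun_prop))]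
    refine intervalIntegral.integral_congr fun s hs => ?_
    rw [Set.uIcc_of_le zero_le_one] at hs
    simp only [Set.IccExtend_of_mem _ _ hs, Pi.mul_apply]
  have hzero := eq_zero_of_moments_eq_zero
    (D := fun s => Set.IccExtend zero_le_one (fun t => f (x t)) s
      - Set.IccExtend zero_le_one (fun t => f (y t)) s)
    ((hcont x).Icc_extend'.sub (hcont y).Icc_extend') (fun k => by
      obtain ⟨K, hK, hK'⟩ := exists_integral_mem_wordSpan τ (hpow k)
      simp only [sub_mul]
      have hint : ∀ z : BVPath W, IntervalIntegrable
          (fun s => Set.IccExtend zero_le_one (fun t => f (z t)) s * s ^ k)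
          MeasureTheory.volume 0 1 := fun z =>
        ((hcont z).Icc_extend'.mul (continuous_pow k)).intervalIntegrable _ _
      rw [intervalIntegral.integral_sub (hint x) (hint y),
        ← hmom k x hx _ (hK' x 1), ← hmom k y hy _ (hK' y 1), hspan hK, sub_self])
  have := hzero t t.2
  simp only [Set.IccExtend_of_mem _ _ t.2] at this
  exact sub_eq_zero.1 this

end Words

/-! ### The strict topology -/

section Strict

variable {X : Type*} [TopologicalSpace X]

theorem withSeminorms_strict :
    WithSeminorms (StrictCb.strictSeminorm (X := X)) := ⟨rfl⟩

theorem StrictCb.strictSeminorm_apply (ψ : BoundedVanishing X) (f : StrictCb X) :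
    StrictCb.strictSeminorm ψ f = ⨆ x, |f x * ψ.1 x| := rfl

theorem StrictCb.exists_bound (f : StrictCb X) : ∃ M : ℝ, 0 ≤ M ∧ ∀ x, |f x| ≤ M :=
  let f' : BoundedContinuousFunction X ℝ := f
  ⟨‖f'‖, norm_nonneg f', f'.norm_coe_le_norm⟩

theorem StrictCb.continuous (f : StrictCb X) : Continuous f :=
  BoundedContinuousFunction.continuous (f : BoundedContinuousFunction X ℝ)

theorem BoundedVanishing.exists_bound_finset (s : Finset (BoundedVanishing X)) :
    ∃ C : ℝ, 0 ≤ C ∧ ∀ ψ ∈ s, ∀ x, |ψ.1 x| ≤ C := by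
  classical
  induction s using Finset.induction_on with
  | empty => exact ⟨0, le_rfl, by simp⟩
  | insert ψ s _ ih =>
    obtain ⟨C, hC0, hC⟩ := ih
    obtain ⟨C', hC'⟩ := ψ.2.1
    refine ⟨max C C', hC0.trans (le_max_left _ _), fun φ hφ x => ?_⟩
    rcases Finset.mem_insert.1 hφ with rfl | h
    · exact (hC' x).trans (le_max_right _ _)
    · exact (hC φ h x).trans (le_max_left _ _)

theorem BoundedVanishing.exists_isCompact_finset (s : Finset (BoundedVanishing X)) {ε : ℝ}
    (hε : 0 < ε) : ∃ K : Set X, IsCompact K ∧ ∀ ψ ∈ s, ∀ x ∉ K, |ψ.1 x| < ε := by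
  choose K hK hK' using fun ψ : BoundedVanishing X => ψ.2.2 ε hε
  refine ⟨⋃ ψ ∈ s, K ψ, s.isCompact_biUnion fun ψ _ => hK ψ, fun ψ hψ x hx => hK' ψ x fun h => ?_⟩
  exact hx (Set.mem_biUnion (x := ψ) hψ h)

/-- **Stone–Weierstrass theorem** for the strict topology: an algebra of bounded continuous
functions that separates the points is strictly dense. -/
theorem dense_strict_of_separatesPoints (A : Subalgebra ℝ C(X, ℝ)) (hA : A.SeparatesPoints)
    (hb : ∀ a ∈ A, ∃ C : ℝ, ∀ x, |a x| ≤ C) :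
    Dense {f : StrictCb X | ∃ a ∈ A, ∀ x, f x = a x} := by
  intro f
  rw [mem_closure_iff_nhds]
  intro U hU
  obtain ⟨s, r, hr, hU⟩ := (withSeminorms_strict.mem_nhds_iff f U).1 hU
  obtain ⟨M, hM0, hM⟩ := f.exists_bound
  obtain ⟨C, hC0, hC⟩ := BoundedVanishing.exists_bound_finset s
  -- Off `K` the error will be at most `2 * M + 1`, on `K` at most `2 * δ` with weights bounded by
  -- `C`. The constants make both contributions at most `r / 2`.
  obtain ⟨K, hK, hKs⟩ := BoundedVanishing.exists_isCompact_finset s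
    (show 0 < r / (2 * (2 * M + 1)) by positivity)
  set δ := min 1 (r / (4 * (C + 1))) with hδ
  have hδ0 : 0 < δ := lt_min one_pos (by positivity)
  obtain ⟨a, haA, ha⟩ :=
    ContinuousMap.exists_mem_subalgebra_near_continuous_of_isCompact_of_separatesPoints hA
      ⟨f, f.continuous⟩ hK hδ0
  obtain ⟨R, hR⟩ := hb a haA
  -- The approximation `a` is uncontrolled off `K`. It is clipped to `[-M, M]` by a polynomial close
  -- to the clipping function on `[-R, R]`, which contains the range of `a`; a polynomial in `a`
  -- stays in the algebra.
  obtain ⟨p, hp⟩ := exists_polynomial_near_of_continuousOn (-R) R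
    (fun u => max (-M) (min M u)) (by fun_prop) δ hδ0
  set g : C(X, ℝ) := Polynomial.aeval a p with hg
  have hgA : g ∈ A := 
    Algebra.adjoin_le (Set.singleton_subset_iff.2 haA) (Polynomial.aeval_mem_adjoin_singleton ℝ a)
  have hgx : ∀ x, |g x - max (-M) (min M (a x))| < δ := fun x => by
    rw [hg, Polynomial.aeval_continuousMap_apply]
    exact hp _ (abs_le.1 (hR x))
  obtain ⟨Cg, hCg⟩ := hb g hgA
  let g' : StrictCb X := BoundedContinuousFunction.ofNormedAddCommGroup g g.continuous Cg hCg
  have hg' : ∀ x, g' x = g x := fun _ => rfl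
  refine ⟨g', hU ?_, g, hgA, hg'⟩
  rw [Seminorm.mem_ball]
  refine Seminorm.finset_sup_apply_lt hr fun ψ hψ => ?_
  rw [StrictCb.strictSeminorm_apply]
  refine (Real.iSup_le (fun x => ?_) (half_pos hr).le).trans_lt (half_lt_self hr)
  have e : (g' - f) x = g x - f x := rfl
  rw [e, abs_mul]
  have h1 := abs_lt.1 (hgx x)
  have h2 := abs_le.1 (hM x)
  by_cases hx : x ∈ K
  · have h3 := abs_lt.1 (ha x hx)
    simp only [ContinuousMap.coe_mk] at h3
    have h4 : |g x - f x| ≤ 2 * δ := by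
      rw [abs_le]
      rcases max_cases (-M) (min M (a x)) with ⟨h5, h6⟩ | ⟨h5, h6⟩ <;>
        rcases min_cases M (a x) with ⟨h7, h8⟩ | ⟨h7, h8⟩ <;>
        constructor <;> linarith [h1.1, h1.2, h2.1, h2.2, h3.1, h3.2]
    have h5 : δ ≤ r / (4 * (C + 1)) := min_le_right _ _
    calc |g x - f x| * |ψ.1 x| ≤ 2 * (r / (4 * (C + 1))) * (C + 1) := by
          gcongr
          · linarith
          · linarith [hC ψ hψ x]
      _ = r / 2 := by field_simp; ring
  · have h4 : |g x - f x| ≤ 2 * M + 1 := by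
      have h5 : δ ≤ 1 := min_le_left _ _
      have h6 : -M ≤ max (-M) (min M (a x)) := le_max_left _ _
      have h7 : max (-M) (min M (a x)) ≤ M := max_le (by linarith) (min_le_left _ _)
      rw [abs_le]
      constructor <;> linarith [h1.1, h1.2, h2.1, h2.2]
    calc |g x - f x| * |ψ.1 x| ≤ (2 * M + 1) * (r / (2 * (2 * M + 1))) := by
          gcongr
          exact (hKs ψ hψ x hx).le
      _ = r / 2 := by field_simp

end Strict

/-! ### Regular measures as strictly continuous functionals -/

section Measures

open MeasureTheory
open scoped ENNReal

variable {X : Type*} [TopologicalSpace X] [MeasurableSpace X] [BorelSpace X]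

theorem StrictCb.integrable (f : StrictCb X) (ν : Measure X) [IsFiniteMeasure ν] :
    Integrable f ν :=
  BoundedContinuousFunction.integrable ν (f : BoundedContinuousFunction X ℝ)

theorem exists_isCompact_measure_compl_lt [T2Space X] (ν : Measure X) [IsFiniteMeasure ν]
    [ν.Regular] {ε : ℝ≥0∞} (hε : ε ≠ 0) : ∃ K, IsCompact K ∧ ν Kᶜ < ε := by
  obtain ⟨K, -, hK, h⟩ := Measure.Regular.innerRegular.exists_subset_lt_add isCompact_empty
    isOpen_univ (measure_ne_top ν Set.univ) hε
  refine ⟨K, hK, ?_⟩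
  rw [← measure_add_measure_compl hK.isClosed.measurableSet] at h
  exact (ENNReal.add_lt_add_iff_left (measure_ne_top ν K)).1 h

/-- A tight finite measure integrates the reciprocal of a function that vanishes at infinity. -/
theorem exists_weight [T2Space X] (ν : Measure X) [IsFiniteMeasure ν] [ν.Regular] :
    ∃ φ : X → ℝ≥0∞, Measurable φ ∧ (∫⁻ x, φ x ∂ν) ≠ ∞ ∧ (∀ x, 1 ≤ φ x) ∧
      ∀ n : ℕ, ∃ K, IsCompact K ∧ ∀ x ∉ K, (2 : ℝ≥0∞) ^ n ≤ φ x := by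
  -- The rate `4⁻ⁿ` beats the height `2ⁿ` that the weight gains off `K n`, so the integral is
  -- bounded by a geometric series.
  choose K hK hKν using fun n : ℕ => exists_isCompact_measure_compl_lt ν
    (ε := ((4 : ℝ≥0∞)⁻¹) ^ n) (pow_ne_zero _ (by simp))
  have hm : ∀ n, Measurable ((K n)ᶜ.indicator fun _ => (2 : ℝ≥0∞) ^ n) := fun n =>
    measurable_const.indicator (hK n).isClosed.measurableSet.compl
  refine ⟨fun x => 1 + ∑' n, (K n)ᶜ.indicator (fun _ => (2 : ℝ≥0∞) ^ n) x,
    measurable_const.add (Measurable.tsum hm), ?_, fun x => le_self_add,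
    fun n => ⟨K n, hK n, fun x hx => ?_⟩⟩
  · rw [lintegral_add_left measurable_const, lintegral_tsum fun n => (hm n).aemeasurable]
    refine ENNReal.add_ne_top.2 ⟨by simp, ?_⟩
    have hle : ∑' n, ∫⁻ x, (K n)ᶜ.indicator (fun _ => (2 : ℝ≥0∞) ^ n) x ∂ν
        ≤ ∑' n : ℕ, ((2 : ℝ≥0∞)⁻¹) ^ n := by
      refine ENNReal.tsum_le_tsum fun n => ?_
      rw [lintegral_indicator_const (hK n).isClosed.measurableSet.compl]
      refine (mul_le_mul_right (hKν n).le _).trans (le_of_eq ?_)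
      rw [← mul_pow]
      congr 1
      rw [show (4 : ℝ≥0∞) = 2 * 2 by norm_num,
        ENNReal.mul_inv (by simp) (by simp), ← mul_assoc,
        ENNReal.mul_inv_cancel (by simp) (by simp), one_mul]
    refine ne_top_of_le_ne_top ?_ hle
    rw [ENNReal.tsum_geometric, ENNReal.one_sub_inv_two, inv_inv]
    simp
  · refine le_add_left (le_trans (le_of_eq ?_) (ENNReal.le_tsum n))
    rw [Set.indicator_of_mem hx]

/-- A regular finite measure defines a strictly continuous functional. -/
theorem exists_strictCLM [T2Space X] (μ : RegularSignedMeasure X) :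
    ∃ D : StrictCb X →L[ℝ] ℝ, ∀ f : StrictCb X, D f = signedIntegral μ.1 f := by
  obtain ⟨μ, hμ⟩ := μ
  obtain ⟨φ, hφm, hφ, hφ1, hφK⟩ := exists_weight μ.totalVariation
  let D : StrictCb X →ₗ[ℝ] ℝ :=
    { toFun := fun f => signedIntegral μ f
      map_add' := fun f g => by
        have e : ∀ x, (f + g) x = f x + g x := fun _ => rfl
        simp only [signedIntegral, e]
        rw [integral_add (f.integrable _) (g.integrable _),
          integral_add (f.integrable _) (g.integrable _)]
        ring
      map_smul' := fun r f => by
        have e : ∀ x, (r • f) x = r * f x := fun _ => rfl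
        simp only [signedIntegral, e, integral_const_mul, RingHom.id_apply, smul_eq_mul]
        ring }
  have hinv : ∀ x, (φ x)⁻¹ ≤ 1 := fun x => ENNReal.inv_le_one.2 (hφ1 x)
  -- The weight `1 / φ` is at most `1`, and at most `2⁻ⁿ` off a compact set.
  let ψ : BoundedVanishing X := ⟨fun x => (φ x)⁻¹.toReal, ⟨1, fun x => by
      rw [abs_of_nonneg ENNReal.toReal_nonneg]
      exact ENNReal.toReal_le_of_le_ofReal zero_le_one (by simpa using hinv x)⟩, fun ε hε => by
      obtain ⟨n, hn⟩ := exists_pow_lt_of_lt_one hε (show (2 : ℝ)⁻¹ < 1 by norm_num)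
      obtain ⟨K, hK, hK'⟩ := hφK n
      refine ⟨K, hK, fun x hx => lt_of_le_of_lt ?_ hn⟩
      rw [abs_of_nonneg ENNReal.toReal_nonneg]
      have h := ENNReal.toReal_mono (by simp) (ENNReal.inv_le_inv.2 (hK' x hx))
      simpa using h⟩
  set c := ∫ x, (φ x).toReal ∂μ.totalVariation with hc
  have hc0 : 0 ≤ c := integral_nonneg fun _ => ENNReal.toReal_nonneg
  refine ⟨⟨D, withSeminorms_strict.continuous_real_rng D ⟨{ψ}, ⟨c, hc0⟩, fun f => ?_⟩⟩, fun f => rfl⟩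
  rw [Finset.sup_singleton]
  change signedIntegral μ f ≤ c * StrictCb.strictSeminorm ψ f
  -- The bound can fail where `φ = ∞`, since `toReal` is `0` there; these points form a null set
  -- because `φ` is integrable.
  have hpt : ∀ᵐ x ∂μ.totalVariation, |f x| ≤ StrictCb.strictSeminorm ψ f * (φ x).toReal := by
    filter_upwards [ae_lt_top hφm hφ] with x hx
    have h1 : |f x * ψ.1 x| ≤ StrictCb.strictSeminorm ψ f :=
      le_ciSup (StrictCb.bddAbove_mul f ψ) x
    have h2 : 0 < (φ x).toReal :=
      ENNReal.toReal_pos (zero_lt_one.trans_le (hφ1 x)).ne' hx.ne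
    have h3 : ψ.1 x = ((φ x).toReal)⁻¹ := ENNReal.toReal_inv _
    rw [abs_mul, h3, abs_of_pos (inv_pos.2 h2), ← div_eq_mul_inv, div_le_iff₀ h2] at h1
    exact h1
  have hle : signedIntegral μ f ≤ ∫ x, |f x| ∂μ.totalVariation := by
    rw [SignedMeasure.totalVariation, integral_add_measure (f.integrable _).abs
      (f.integrable _).abs, signedIntegral]
    have h1 := (le_abs_self _).trans
      (abs_integral_le_integral_abs (f := f) (μ := μ.toJordanDecomposition.posPart))
    have h2 := (neg_le_abs _).trans
      (abs_integral_le_integral_abs (f := f) (μ := μ.toJordanDecomposition.negPart))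
    linarith
  refine hle.trans ((integral_mono_ae (f.integrable _).abs
    ((integrable_toReal_of_lintegral_ne_top hφm.aemeasurable hφ).const_mul _) hpt).trans
    (le_of_eq ?_))
  rw [integral_const_mul, mul_comm]

/-- Moving the negative parts across gives the identity `μ⁺ + ν⁻ = ν⁺ + μ⁻` of finite positive
measures, which bounded continuous functions determine. -/
theorem signedMeasure_eq_of_signedIntegral_eq [HasOuterApproxClosed X] {μ ν : SignedMeasure X}
    (h : ∀ f : StrictCb X, signedIntegral μ f = signedIntegral ν f) : μ = ν := by
  have key : μ.toJordanDecomposition.posPart + ν.toJordanDecomposition.negPart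
      = ν.toJordanDecomposition.posPart + μ.toJordanDecomposition.negPart := by
    refine ext_of_forall_integral_eq_of_IsFiniteMeasure fun f => ?_
    have hf : ∫ x, f x ∂μ.toJordanDecomposition.posPart - ∫ x, f x ∂μ.toJordanDecomposition.negPart
        = ∫ x, f x ∂ν.toJordanDecomposition.posPart - ∫ x, f x ∂ν.toJordanDecomposition.negPart :=
      h f
    rw [integral_add_measure (f.integrable _) (f.integrable _),
      integral_add_measure (f.integrable _) (f.integrable _)]
    linarith
  ext s hs
  rw [SignedMeasure.apply_eq_posPart_real_sub_negPart_real μ hs,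
    SignedMeasure.apply_eq_posPart_real_sub_negPart_real ν hs]
  have h1 : Measure.real _ s = Measure.real _ s := congrArg (fun m : Measure X => m.real s) key
  rw [measureReal_add_apply, measureReal_add_apply] at h1
  linarith

/-- A universal feature map is characteristic. -/
theorem IsUniversal.isCharacteristicToMeasures {E : Type*} [AddCommGroup E] [Module ℝ E]
    [TopologicalSpace E] [T2Space X] [HasOuterApproxClosed X] {Φ : X → E} (h : IsUniversal Φ) :
    IsCharacteristicToMeasures Φ := by
  refine ⟨exists_strictCLM, h.1, fun μ ν hμν => Subtype.ext
    (signedMeasure_eq_of_signedIntegral_eq fun f => ?_)⟩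
  obtain ⟨D, hD⟩ := exists_strictCLM μ
  obtain ⟨D', hD'⟩ := exists_strictCLM ν
  rw [← hD, ← hD']
  -- Continuous functionals that agree on the dense set of features agree everywhere.
  refine congrFun (D.continuous.ext_on h.2 D'.continuous ?_) f
  rintro g ⟨l, hl⟩
  rw [hD, hD', show (g : X → ℝ) = fun x => l (Φ x) from funext hl]
  exact congrFun hμν l

end Measures

/-! ### The normalized signature -/

section Main

variable {V : Type*} {W : Type u} [NormedAddCommGroup V] [NormedSpace ℝ V] [NormedAddCommGroup W]
  [NormedSpace ℝ W] {N : AdmissibleTensorNorms W}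

theorem isCbFeature_of_isBounded {X E : Type*} [TopologicalSpace X] [NormedAddCommGroup E]
    [NormedSpace ℝ E] {Φ : X → E} (hΦ : Continuous Φ) (hb : Bornology.IsBounded (Set.range Φ)) :
    IsCbFeature Φ := by
  intro l
  obtain ⟨K, hK⟩ := hb.exists_norm_le
  exact ⟨BoundedContinuousFunction.ofNormedAddCommGroup (fun x => l (Φ x))
    (l.continuous.comp hΦ) (‖l‖ * K) fun x =>
      (l.le_opNorm _).trans (by gcongr; exact hK _ ⟨x, rfl⟩), fun _ => rfl⟩

/-- The functional on tensor series given by a word. -/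
def seriesFun (N : AdmissibleTensorNorms W) (w : List (W →L[ℝ] ℝ)) : TensorSeries N →L[ℝ] ℝ :=
  (wordFun N w).comp (lp.evalCLM ℝ (fun n => BanachTensor N n) 2 w.length)

/-- The projection of the time-augmented space to the time coordinate. -/
def timeCoord (e : (V × ℝ) ≃L[ℝ] W) : W →L[ℝ] ℝ :=
  (ContinuousLinearMap.snd ℝ V ℝ).comp (e.symm : W →L[ℝ] V × ℝ)

theorem timeCoord_timeAugment (e : (V × ℝ) ≃L[ℝ] W) (x : BVPath V) (t : unitInterval) :
    timeCoord e (x.timeAugment e t) = t := by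
  change (e.symm (e (x t, (t : ℝ)))).2 = t
  rw [e.symm_apply_apply]

theorem timeAugment_injective (e : (V × ℝ) ≃L[ℝ] W) :
    Function.Injective (BVPath.timeAugment (V := V) e) := by
  intro x y h
  refine BVPath.ext' fun t => ?_
  have h' : e (x t, (t : ℝ)) = e (y t, (t : ℝ)) := congrArg (fun z : BVPath W => z t) h
  exact (Prod.ext_iff.1 (e.injective h')).1

theorem seriesFun_normalizedSignature (e : (V × ℝ) ≃L[ℝ] W)
    {Λ : TensorSeriesOne N → TensorSeriesOne N} {lam : TensorSeriesOne N → ℝ}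
    (hlam : ∀ t m, (Λ t : TensorSeries N) m = lam t ^ m • (t : TensorSeries N) m)
    (w : List (W →L[ℝ] ℝ)) (x : BVPath V) :
    seriesFun N w (normalizedSignature e N Λ x)
      = lam (signature N (x.timeAugment e)) ^ w.length * wordIntegral N w (x.timeAugment e) 1 := by
  change wordFun N w ((Λ (signature N (x.timeAugment e)) : TensorSeries N) w.length) = _
  rw [hlam, map_smul]
  rfl

/-- Words separate paths, even after the normalization. -/
theorem eq_of_seriesFun_eq (e : (V × ℝ) ≃L[ℝ] W) {Λ : TensorSeriesOne N → TensorSeriesOne N}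
    (hΛ : IsTensorNormalization N Λ) {x y : BVPath V}
    (h : ∀ w, seriesFun N w (normalizedSignature e N Λ x)
      = seriesFun N w (normalizedSignature e N Λ y)) : x = y := by
  obtain ⟨lam, hpos, hlam⟩ := hΛ.dilation
  simp only [seriesFun_normalizedSignature e hlam] at h
  -- The time word has integral `1`, so its normalized value is the dilation factor. The two factors
  -- are thus equal, and their powers cancel from every other word.
  have h1 := h [timeCoord e]
  simp only [wordIntegral_singleton, timeCoord_timeAugment, List.length_singleton, pow_one,
    Set.Icc.coe_one, mul_one] at h1
  refine timeAugment_injective e (eq_of_wordIntegral_eq (N := N) (timeCoord_timeAugment e x)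
    (timeCoord_timeAugment e y) fun w => ?_)
  have h2 := h w
  rw [h1] at h2
  exact mul_left_cancel₀ (pow_ne_zero _ (hpos _).ne') h2

theorem normalizedSignature_injective (e : (V × ℝ) ≃L[ℝ] W)
    {Λ : TensorSeriesOne N → TensorSeriesOne N} (hΛ : IsTensorNormalization N Λ) :
    Function.Injective (normalizedSignature e N Λ) := fun x y h =>
  eq_of_seriesFun_eq e hΛ fun w => by rw [h]

theorem isBounded_range_normalizedSignature (e : (V × ℝ) ≃L[ℝ] W)
    {Λ : TensorSeriesOne N → TensorSeriesOne N} (hΛ : IsTensorNormalization N Λ) :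
    Bornology.IsBounded (Set.range (normalizedSignature (V := V) e N Λ)) := by
  obtain ⟨K, -, hK⟩ := hΛ.bounded
  refine isBounded_iff_forall_norm_le.2 ⟨K, ?_⟩
  rintro _ ⟨x, rfl⟩
  exact hK _

/-- The linear functionals of the normalized signature contain a separating algebra. -/
theorem exists_subalgebra_normalizedSignature (e : (V × ℝ) ≃L[ℝ] W)
    {Λ : TensorSeriesOne N → TensorSeriesOne N} (hΛ : IsTensorNormalization N Λ) :
    ∃ A : Subalgebra ℝ C(BVPath V, ℝ), A.SeparatesPoints ∧
      ∀ a ∈ A, ∃ l : TensorSeries N →L[ℝ] ℝ, ∀ x, a x = l (normalizedSignature e N Λ x) := by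
  obtain ⟨lam, -, hlam⟩ := hΛ.dilation
  let φ : (TensorSeries N →L[ℝ] ℝ) →ₗ[ℝ] C(BVPath V, ℝ) :=
    { toFun := fun l => ⟨fun x => l (normalizedSignature e N Λ x),
        l.continuous.comp (continuous_normalizedSignature e N hΛ.continuous)⟩
      map_add' := fun _ _ => rfl
      map_smul' := fun _ _ => rfl }
  have hφ : ∀ w x, φ (seriesFun N w) x = lam (signature N (x.timeAugment e)) ^ w.length
      * wordIntegral N w (x.timeAugment e) 1 := seriesFun_normalizedSignature e hlam
  set P : Submodule ℝ C(BVPath V, ℝ) := Submodule.span ℝ (Set.range fun w => φ (seriesFun N w))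
    with hP
  have hmem : ∀ w, φ (seriesFun N w) ∈ P := fun w => Submodule.subset_span ⟨w, rfl⟩
  -- Words of the same length carry the same power of the dilation factor, so a homogeneous
  -- combination of them survives the normalization. This is why the spans are graded by length.
  have hspan : ∀ (n : ℕ) (H : BVPath W → unitInterval → ℝ), H ∈ wordSpan N n →
      ∃ a ∈ P, ∀ x, a x = lam (signature N (x.timeAugment e)) ^ n * H (x.timeAugment e) 1 := by
    intro n H hH
    induction hH using Submodule.span_induction with
    | mem H h =>
      obtain ⟨w, rfl, rfl⟩ := h
      exact ⟨_, hmem w, hφ w⟩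
    | zero => exact ⟨0, zero_mem _, fun x => by simp⟩
    | add H H' _ _ ih ih' =>
      obtain ⟨a, ha, h⟩ := ih
      obtain ⟨a', ha', h'⟩ := ih'
      refine ⟨a + a', add_mem ha ha', fun x => ?_⟩
      simp only [ContinuousMap.add_apply, h, h', Pi.add_apply, mul_add]
    | smul r H _ ih =>
      obtain ⟨a, ha, h⟩ := ih
      refine ⟨r • a, P.smul_mem r ha, fun x => ?_⟩
      simp only [ContinuousMap.smul_apply, h, Pi.smul_apply, smul_eq_mul]
      ring
  have hone : (1 : C(BVPath V, ℝ)) ∈ P := by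
    have : (1 : C(BVPath V, ℝ)) = φ (seriesFun N []) := by
      ext x
      rw [hφ, wordIntegral_nil]
      simp
    rw [this]
    exact hmem []
  have hmul : ∀ a b, a ∈ P → b ∈ P → a * b ∈ P := by
    intro a b ha hb
    have h := Submodule.mul_mem_mul ha hb
    rw [hP, Submodule.span_mul_span] at h
    refine Submodule.span_le.2 ?_ h
    rintro _ ⟨_, ⟨w, rfl⟩, _, ⟨w', rfl⟩, rfl⟩
    -- The shuffle product has length `w.length + w'.length`, and its power of the dilation factor
    -- is the product of the two given powers.
    obtain ⟨c, hc, hc'⟩ := hspan _ _ (wordIntegral_mul_mem (N := N) _ w w' rfl)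
    have : φ (seriesFun N w) * φ (seriesFun N w') = c := by
      ext x
      rw [ContinuousMap.mul_apply, hφ, hφ, hc', pow_add, Pi.mul_apply, Pi.mul_apply]
      ring
    simp only [SetLike.mem_coe]
    rw [this]
    exact hc
  refine ⟨P.toSubalgebra hone hmul, ?_, fun a ha => ?_⟩
  · intro x y hxy
    by_contra! hne
    refine hxy (eq_of_seriesFun_eq e hΛ fun w => ?_)
    exact hne _ ⟨φ (seriesFun N w), hmem w, rfl⟩
  · have hle : P ≤ LinearMap.range φ := Submodule.span_le.2 (by rintro _ ⟨w, rfl⟩; exact ⟨_, rfl⟩)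
    obtain ⟨l, rfl⟩ := hle ha
    exact ⟨l, fun _ => rfl⟩

theorem isUniversal_normalizedSignature (e : (V × ℝ) ≃L[ℝ] W)
    {Λ : TensorSeriesOne N → TensorSeriesOne N} (hΛ : IsTensorNormalization N Λ) :
    IsUniversal (normalizedSignature (V := V) e N Λ) := by
  have hcb := isCbFeature_of_isBounded (continuous_normalizedSignature e N hΛ.continuous)
    (isBounded_range_normalizedSignature (V := V) e hΛ)
  obtain ⟨A, hA, hAl⟩ := exists_subalgebra_normalizedSignature (V := V) e hΛ
  refine ⟨hcb, (dense_strict_of_separatesPoints A hA fun a ha => ?_).mono ?_⟩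
  · obtain ⟨l, hl⟩ := hAl a ha
    obtain ⟨f, hf⟩ := hcb l
    obtain ⟨M, -, hM⟩ := f.exists_bound
    exact ⟨M, fun x => by rw [hl, ← hf]; exact hM x⟩
  · rintro f ⟨a, ha, hfa⟩
    obtain ⟨l, hl⟩ := hAl a ha
    exact ⟨l, fun x => (hfa x).trans (hl x)⟩

end Main

end SigFeature

end

theorem mainTheorem4 {V W : Type*}
    [NormedAddCommGroup V] [NormedSpace ℝ V] [CompleteSpace V]
    [NormedAddCommGroup W] [NormedSpace ℝ W]
    (e : (V × ℝ) ≃L[ℝ] W) (N : AdmissibleTensorNorms W)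
    (Λ : TensorSeriesOne N → TensorSeriesOne N) (hΛ : IsTensorNormalization N Λ) :
    -- the iterated Riemann–Stieltjes integrals that define the signature exist
    (∀ (x : BVPath V) (m : ℕ) (t : unitInterval),
      HasRSIntegral (tensorRight N m) (iteratedIntegral N (x.timeAugment e) m) (x.timeAugment e)
        0 t (iteratedIntegral N (x.timeAugment e) (m + 1) t)) ∧
    -- a continuous injection into a bounded set
    (Continuous (normalizedSignature e N Λ) ∧
      Function.Injective (normalizedSignature e N Λ) ∧
      Bornology.IsBounded (Set.range (normalizedSignature e N Λ))) ∧
    IsUniversal (normalizedSignature e N Λ) ∧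
    IsCharacteristicToMeasures (normalizedSignature e N Λ) := by
  have hU := isUniversal_normalizedSignature (V := V) e hΛ
  exact ⟨fun x => hasRSIntegral_iteratedIntegral N (x.timeAugment e),
    ⟨continuous_normalizedSignature e N hΛ.continuous, normalizedSignature_injective e hΛ,
      isBounded_range_normalizedSignature e hΛ⟩, hU, hU.isCharacteristicToMeasures⟩
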